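/- There is a deterministic algorithm on the word RAM (words of $\Theta(\log n)$ bits; additions, subtractions, multiplications, comparisons, memory accesses and printing a word at unit cost; memory initially zero outside the input) that, given the edge list of any simple undirected graph $G$ with $n$ nodes and $m$ edges, lists every $4$-cycle of $G$ (as a subgraph) exactly once and halts within $$O\bigl(1+\min\bigl(n^2+t,\ (m^{4/3}+t)\cdot\log^2 n\bigr)\bigr)$$ steps, where $t$ is the number of $4$-cycles of $G$ and the constant hidden in the $O$ is absolute. (The algorithm works for every word size $w\ge c\log_2(n+2)$, where $c$ is an absolute constant.) -/

import Mathlib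

namespace WordRAM

/-! A deterministic word RAM. For word size `w`, every register and every memory cell holds a
natural number below `2 ^ w`, arithmetic is modulo `2 ^ w`, and there are `2 ^ w` addressable
memory cells. A program is a fixed finite text that does not depend on `w` or on the input. -/

/-- A comparison of the contents of two registers. -/
inductive Test where
  | lt (x y : ℕ)
  | eq (x y : ℕ)

/-- Programs. Arguments named `d`, `x`, `y`, `a` are register numbers. -/
inductive Prog where
  /-- do nothing -/
  | skip
  /-- `d := k` for a literal `k` -/
  | const (d k : ℕ)
  /-- `d := x` -/
  | copy (d x : ℕ)
  /-- `d := x + y` -/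
  | add (d x y : ℕ)
  /-- `d := x - y` -/
  | sub (d x y : ℕ)
  /-- `d := x * y` -/
  | mul (d x y : ℕ)
  /-- `d := memory[a]` -/
  | load (d a : ℕ)
  /-- `memory[a] := x` -/
  | store (a x : ℕ)
  /-- append the content of `x` to the output -/
  | print (x : ℕ)
  /-- sequential composition -/
  | seq (p q : Prog)
  /-- `if b then p else q` -/
  | ite (b : Test) (p q : Prog)
  /-- `while b do p` -/
  | loop (b : Test) (p : Prog)

/-- A state of the machine: registers, memory, and the words printed so far (in order). -/
structure State where
  reg : ℕ → ℕ
  mem : ℕ → ℕ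
  out : List ℕ

/-- Write the word `v` (reduced modulo `2 ^ w`) into register `d`. -/
def State.setReg (w : ℕ) (s : State) (d v : ℕ) : State :=
  { s with reg := Function.update s.reg d (v % 2 ^ w) }

/-- The truth value of a test in a state. -/
def Test.holds : Test → State → Prop
  | .lt x y, s => s.reg x < s.reg y
  | .eq x y, s => s.reg x = s.reg y

/-- `Exec w p s s' T`: with word size `w`, program `p` started in state `s` halts in state `s'`
after exactly `T` steps. Every instruction and every evaluation of a test costs one step. -/
inductive Exec (w : ℕ) : Prog → State → State → ℕ → Prop where
  | skip (s : State) : Exec w .skip s s 1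
  | const (s : State) (d k : ℕ) : Exec w (.const d k) s (s.setReg w d k) 1
  | copy (s : State) (d x : ℕ) : Exec w (.copy d x) s (s.setReg w d (s.reg x)) 1
  | add (s : State) (d x y : ℕ) :
      Exec w (.add d x y) s (s.setReg w d (s.reg x + s.reg y)) 1
  | sub (s : State) (d x y : ℕ) :
      Exec w (.sub d x y) s (s.setReg w d (s.reg x + (2 ^ w - s.reg y))) 1
  | mul (s : State) (d x y : ℕ) :
      Exec w (.mul d x y) s (s.setReg w d (s.reg x * s.reg y)) 1
  | load (s : State) (d a : ℕ) :
      Exec w (.load d a) s (s.setReg w d (s.mem (s.reg a))) 1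
  | store (s : State) (a x : ℕ) :
      Exec w (.store a x) s { s with mem := Function.update s.mem (s.reg a) (s.reg x) } 1
  | print (s : State) (x : ℕ) :
      Exec w (.print x) s { s with out := s.out ++ [s.reg x] } 1
  | seq {p q : Prog} {s₁ s₂ s₃ : State} {T₁ T₂ : ℕ} :
      Exec w p s₁ s₂ T₁ → Exec w q s₂ s₃ T₂ → Exec w (.seq p q) s₁ s₃ (T₁ + T₂)
  | ite_true {b : Test} {p q : Prog} {s s' : State} {T : ℕ} :
      b.holds s → Exec w p s s' T → Exec w (.ite b p q) s s' (T + 1)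
  | ite_false {b : Test} {p q : Prog} {s s' : State} {T : ℕ} :
      ¬ b.holds s → Exec w q s s' T → Exec w (.ite b p q) s s' (T + 1)
  | loop_done {b : Test} {p : Prog} {s : State} :
      ¬ b.holds s → Exec w (.loop b p) s s 1
  | loop_step {b : Test} {p : Prog} {s₁ s₂ s₃ : State} {T₁ T₂ : ℕ} :
      b.holds s₁ → Exec w p s₁ s₂ T₁ → Exec w (.loop b p) s₂ s₃ T₂ →
        Exec w (.loop b p) s₁ s₃ (T₁ + T₂ + 1)

/-- The initial state: the input occupies the first memory cells, and all other cells and all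
registers are zero. -/
def initState (input : List ℕ) : State where
  reg := fun _ => 0
  mem := fun i => input.getD i 0
  out := []

end WordRAM

namespace FourCycle

/-- `edges` lists every edge of `G` exactly once, in any order and with its two endpoints in any
order. -/
def IsEdgeList {n : ℕ} (G : SimpleGraph (Fin n)) (edges : List (Fin n × Fin n)) : Prop :=
  (edges.map fun e => s(e.1, e.2)).Nodup ∧
    ∀ e : Sym2 (Fin n), e ∈ G.edgeSet ↔ e ∈ edges.map fun e => s(e.1, e.2)

/-- The input words: the number of nodes, the number of edges, then the endpoints of the edges. -/
def encodeInput {n : ℕ} (edges : List (Fin n × Fin n)) : List ℕ :=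
  n :: edges.length :: edges.flatMap fun e => [(e.1 : ℕ), (e.2 : ℕ)]

/-- `a, b, c, d` are the consecutive nodes of a 4-cycle of `G` (`a ≠ c` and `b ≠ d` are the only
inequalities not forced by adjacency). -/
def IsFourCycle {n : ℕ} (G : SimpleGraph (Fin n)) (q : Fin n × Fin n × Fin n × Fin n) : Prop :=
  match q with
  | (a, b, c, d) => G.Adj a b ∧ G.Adj b c ∧ G.Adj c d ∧ G.Adj d a ∧ a ≠ c ∧ b ≠ d

/-- The edge set of the closed walk through `a, b, c, d`. It determines a 4-cycle as a subgraph,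
regardless of its starting node and direction. -/
def cycleEdges {n : ℕ} (q : Fin n × Fin n × Fin n × Fin n) : Finset (Sym2 (Fin n)) :=
  match q with
  | (a, b, c, d) => {s(a, b), s(b, c), s(c, d), s(d, a)}

/-- The 4-cycles of `G`, as subgraphs (given by their edge sets). -/
def fourCycles {n : ℕ} (G : SimpleGraph (Fin n)) : Set (Finset (Sym2 (Fin n))) :=
  {C | ∃ q, IsFourCycle G q ∧ cycleEdges q = C}

/-- The output `out` lists all 4-cycles of `G`: it consists of quadruples of consecutive nodes of
4-cycles, and each 4-cycle of `G` is listed exactly once. -/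
def ListsFourCycles {n : ℕ} (G : SimpleGraph (Fin n)) (out : List ℕ) : Prop :=
  ∃ L : List (Fin n × Fin n × Fin n × Fin n),
    out = L.flatMap (fun q => [(q.1 : ℕ), (q.2.1 : ℕ), (q.2.2.1 : ℕ), (q.2.2.2 : ℕ)]) ∧
    (∀ q ∈ L, IsFourCycle G q) ∧
    (L.map cycleEdges).Nodup ∧
    ∀ C ∈ fourCycles G, C ∈ L.map cycleEdges

end FourCycle

/-! Rank the nodes by degree, ties broken by number. A 4-cycle has a unique node `v` of largest
rank. If `w` is the node opposite to `v`, the cycle is the union of two paths `v, u, w` and `v, x,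
w` whose other nodes rank below `v`. The program enumerates all such paths, keeps for every pair
`(v, w)` a stack of the middle nodes met so far, and joins each new path with every entry of its
stack. Each unordered pair of paths, hence each 4-cycle, is produced once
(`IsEdgeList.listsFourCycles`).

For an edge directed from `v` down to `u` the enumeration scans the neighbours of `u`, which has the
smaller degree of the two. All other work is constant per edge and per printed cycle, so what
matters is the sum of the smaller endpoint degree over the edges. In the subgraph induced on `N`
nodes let `E` be the sum of the degrees, `X` the sum of their squares, and let `H` be the number of
labelled 4-cycles of `G`, which is `O(t)`. Cauchy-Schwarz for degrees gives `E² ≤ N X`, and for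
codegrees `X² ≤ N² (H + 2X)` (`sqDeg_sq_le`). On the whole graph the second inequality yields `O(n²
+ t)`. For the other bound, a minimum of degrees is the number of thresholds `D ≥ 1` below both of
them. At most `2m / D` nodes have degree at least `D`, and the two inequalities bound their induced
degree sum by `O((m^(4/3) + t) / D)` (`mul_sumDeg_bound`). The harmonic sum over `D ≤ n` costs a
single logarithm, which is stronger than needed.

On the machine, stack cells are addressed by four digits in base `n + 2`. Since memory starts at
zero, all stacks start empty and no time is spent on clearing the `n²` of them. Correctness and time
are proved together in a weakest-precondition calculus. -/

namespace FourCycle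

/-! ### Recorded paths and their pairs, as lists. -/

section Lists

variable {α : Type*} [DecidableEq α]

/-- The neighbours of `v` along the edges in a list. -/
def nbrs (E : List (α × α)) (v : α) : List α :=
  E.flatMap fun e => (if e.1 = v then [e.2] else []) ++ if e.2 = v then [e.1] else []

/-- The middle nodes of the recorded paths from `v` to `w`; the latest path is the head of the
list, the latest middle node comes last. -/
def mids : List (α × α × α) → α → α → List α
  | [], _, _ => []
  | t :: P, v, w => if t.1 = v ∧ t.2.2 = w then mids P v w ++ [t.2.1] else mids P v w

/-- The 4-cycles formed by two recorded paths with the same ends. -/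
def pairUp : List (α × α × α) → List (α × α × α × α)
  | [] => []
  | t :: P => pairUp P ++ (mids P t.1 t.2.2).map fun x => (t.1, t.2.1, t.2.2, x)

/-- The edge `e` directed from its endpoint with the larger key. -/
def orient (key : α → ℕ) (e : α × α) : α × α := if key e.1 < key e.2 then (e.2, e.1) else e

/-- The paths that start with the directed edge `(v, u)` and avoid nodes above `v`. -/
def extend (key : α → ℕ) (v u : α) (l : List α) : List (α × α × α) :=
  (l.filter fun w => key w < key v).map fun w => (v, u, w)

/-- All paths whose start has a larger key than its other two nodes. -/
def downPaths (key : α → ℕ) (adj : α → List α) (E : List (α × α)) : List (α × α × α) :=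
  E.flatMap fun e => extend key (orient key e).1 (orient key e).2 (adj (orient key e).2)

theorem mem_mids {P : List (α × α × α)} {v w u : α} : u ∈ mids P v w ↔ (v, u, w) ∈ P := by
  induction P with
  | nil => simp [mids]
  | cons t P ih =>
    obtain ⟨a, b, c⟩ := t
    simp only [mids]
    split_ifs with h
    · obtain ⟨rfl, rfl⟩ := h
      simp [ih, or_comm]
    · rw [ih, List.mem_cons]
      simp only [Prod.mk.injEq]
      constructor
      · exact Or.inr
      · rintro (⟨rfl, -, rfl⟩ | h')
        · exact absurd ⟨rfl, rfl⟩ h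
        · exact h'

theorem nodup_mids {P : List (α × α × α)} (hP : P.Nodup) (v w : α) : (mids P v w).Nodup := by
  induction P with
  | nil => simp [mids]
  | cons t P ih =>
    obtain ⟨a, b, c⟩ := t
    rw [List.nodup_cons] at hP
    simp only [mids]
    split_ifs with h
    · obtain ⟨rfl, rfl⟩ := h
      rw [← List.concat_eq_append, List.nodup_concat]
      exact ⟨fun hm => hP.1 (mem_mids.1 hm), ih hP.2⟩
    · exact ih hP.2

/-- The middle nodes differ because no path is recorded twice. -/
theorem mem_pairUp {P : List (α × α × α)} (hP : P.Nodup) {v u w x : α}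
    (h : (v, u, w, x) ∈ pairUp P) : (v, u, w) ∈ P ∧ (v, x, w) ∈ P ∧ u ≠ x := by
  induction P with
  | nil => simp [pairUp] at h
  | cons t P ih =>
    obtain ⟨a, b, c⟩ := t
    rw [List.nodup_cons] at hP
    simp only [pairUp, List.mem_append, List.mem_map, Prod.mk.injEq] at h
    rcases h with h | ⟨y, hy, rfl, rfl, rfl, rfl⟩
    · obtain ⟨h1, h2, h3⟩ := ih hP.2 h
      exact ⟨List.mem_cons_of_mem _ h1, List.mem_cons_of_mem _ h2, h3⟩
    · rw [mem_mids] at hy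
      refine ⟨List.mem_cons_self, List.mem_cons_of_mem _ hy, ?_⟩
      rintro rfl
      exact hP.1 hy

/-- The path recorded later is paired with the earlier one. The disjunction reflects that either may
be the later. -/
theorem pairUp_complete {P : List (α × α × α)} {v u w x : α} (hu : (v, u, w) ∈ P)
    (hx : (v, x, w) ∈ P) (hne : u ≠ x) : (v, u, w, x) ∈ pairUp P ∨ (v, x, w, u) ∈ pairUp P := by
  induction P with
  | nil => simp at hu
  | cons t P ih =>
    simp only [pairUp, List.mem_append, List.mem_map]
    rcases List.mem_cons.1 hu with rfl | hu'
    · rcases List.mem_cons.1 hx with h | hx'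
      · simp only [Prod.mk.injEq, true_and, and_true] at h
        exact absurd h.symm hne
      · exact Or.inl (Or.inr ⟨x, mem_mids.2 hx', rfl⟩)
    · rcases List.mem_cons.1 hx with rfl | hx'
      · exact Or.inr (Or.inr ⟨u, mem_mids.2 hu', rfl⟩)
      · exact (ih hu' hx').imp Or.inl Or.inl

theorem mem_nbrs {E : List (α × α)} {v y : α} :
    y ∈ nbrs E v ↔ s(v, y) ∈ E.map fun e => s(e.1, e.2) := by
  simp only [nbrs, List.mem_flatMap, List.mem_append, List.mem_ite_nil_right, List.mem_singleton,
    List.mem_map, Sym2.eq_iff]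
  refine exists_congr fun e => and_congr_right fun _ => ?_
  constructor
  · rintro (⟨h1, h2⟩ | ⟨h1, h2⟩)
    · exact Or.inl ⟨h1, h2.symm⟩
    · exact Or.inr ⟨h2.symm, h1⟩
  · rintro (⟨h1, h2⟩ | ⟨h1, h2⟩)
    · exact Or.inl ⟨h1, h2.symm⟩
    · exact Or.inr ⟨h2, h1.symm⟩

theorem nodup_nbrs {E : List (α × α)} (hE : (E.map fun e => s(e.1, e.2)).Nodup)
    (hne : ∀ e ∈ E, e.1 ≠ e.2) (v : α) : (nbrs E v).Nodup := by
  induction E with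
  | nil => simp [nbrs]
  | cons e E ih =>
    rw [List.map_cons, List.nodup_cons] at hE
    have ih' := ih hE.2 fun e he => hne e (List.mem_cons_of_mem _ he)
    have hee := hne e List.mem_cons_self
    have hcons : nbrs (e :: E) v =
        ((if e.1 = v then [e.2] else []) ++ if e.2 = v then [e.1] else []) ++ nbrs E v := by
      simp [nbrs]
    rw [hcons]
    split_ifs with h1 h2 h2
    · exact absurd (h1.trans h2.symm) hee
    · simp only [List.append_nil, List.singleton_append, List.nodup_cons]
      refine ⟨fun h => hE.1 ?_, ih'⟩
      rw [mem_nbrs, ← h1] at h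
      exact h
    · simp only [List.nil_append, List.singleton_append, List.nodup_cons]
      refine ⟨fun h => hE.1 ?_, ih'⟩
      rw [mem_nbrs, ← h2, Sym2.eq_swap] at h
      exact h
    · simpa using ih'

end Lists

/-! ### Every 4-cycle is found exactly once, from its top node. -/

section Graph

variable {n : ℕ} {G : SimpleGraph (Fin n)} {edges : List (Fin n × Fin n)}

theorem IsEdgeList.adj_iff (h : IsEdgeList G edges) {v y : Fin n} :
    y ∈ nbrs edges v ↔ G.Adj v y := by
  rw [mem_nbrs, ← h.2, SimpleGraph.mem_edgeSet]

theorem IsEdgeList.adj_of_mem (h : IsEdgeList G edges) {e : Fin n × Fin n} (he : e ∈ edges) :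
    G.Adj e.1 e.2 := by
  rw [← SimpleGraph.mem_edgeSet, h.2]
  exact List.mem_map_of_mem he

theorem IsEdgeList.nodup_nbrs (h : IsEdgeList G edges) (v : Fin n) : (nbrs edges v).Nodup :=
  FourCycle.nodup_nbrs h.1 (fun _ he => (h.adj_of_mem he).ne) v

theorem IsEdgeList.length_nbrs [DecidableRel G.Adj] (h : IsEdgeList G edges) (v : Fin n) :
    (nbrs edges v).length = G.degree v := by
  rw [← List.toFinset_card_of_nodup (h.nodup_nbrs v), ← SimpleGraph.card_neighborFinset_eq_degree]
  congr 1
  ext y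
  simp [h.adj_iff]

/-- While the adjacency lists are under construction, this keeps their lengths at most `n`. -/
theorem IsEdgeList.of_prefix_nodup {l₁ l₂ : List (Fin n × Fin n)} (h : IsEdgeList G (l₁ ++ l₂))
    (v : Fin n) : (nbrs l₁ v).Nodup := by
  refine FourCycle.nodup_nbrs ?_ (fun e he => (h.adj_of_mem (List.mem_append_left _ he)).ne) v
  have := h.1
  rw [List.map_append] at this
  exact (List.nodup_append.1 this).1

variable {key : Fin n → ℕ}

theorem orient_sym2 (e : Fin n × Fin n) :
    s((orient key e).1, (orient key e).2) = s(e.1, e.2) := by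
  unfold orient
  split_ifs
  · exact Sym2.eq_swap
  · rfl

theorem orient_lt (hkey : Function.Injective key) {e : Fin n × Fin n} (he : e.1 ≠ e.2) :
    key (orient key e).2 < key (orient key e).1 := by
  unfold orient
  split_ifs with h
  · exact h
  · exact lt_of_le_of_ne (not_lt.1 h) fun h' => he (hkey h').symm

theorem IsEdgeList.mem_downPaths (h : IsEdgeList G edges) (hkey : Function.Injective key)
    {v u w : Fin n} : (v, u, w) ∈ downPaths key (nbrs edges) edges ↔
      G.Adj v u ∧ G.Adj u w ∧ key u < key v ∧ key w < key v := by
  simp only [downPaths, extend, List.mem_flatMap, List.mem_map, List.mem_filter, h.adj_iff,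
    decide_eq_true_eq, Prod.mk.injEq]
  constructor
  · rintro ⟨e, he, x, ⟨hx, hlt⟩, rfl, rfl, rfl⟩
    have hadj := h.adj_of_mem he
    refine ⟨?_, hx, orient_lt hkey hadj.ne, hlt⟩
    rw [← SimpleGraph.mem_edgeSet, orient_sym2]
    exact hadj
  · rintro ⟨h1, h2, h3, h4⟩
    have hm := (h.2 s(v, u)).1 h1
    rw [List.mem_map] at hm
    obtain ⟨e, he, hes⟩ := hm
    have ho : (orient key e).1 = v ∧ (orient key e).2 = u := by
      have hlt := orient_lt hkey (h.adj_of_mem he).ne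
      have hs := orient_sym2 (key := key) e
      rw [hes, Sym2.eq_iff] at hs
      rcases hs with hs | ⟨hs1, hs2⟩
      · exact hs
      · rw [hs1, hs2] at hlt
        exact absurd hlt h3.asymm
    exact ⟨e, he, w, ⟨by rw [ho.2]; exact h2, by rw [ho.1]; exact h4⟩, ho.1, ho.2, rfl⟩

theorem IsEdgeList.nodup_downPaths (h : IsEdgeList G edges) :
    (downPaths key (nbrs edges) edges).Nodup := by
  unfold downPaths
  rw [List.nodup_flatMap]
  constructor
  · intro e _
    refine List.Nodup.map ?_ ((h.nodup_nbrs _).filter _)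
    intro a b hab
    simpa using hab
  · have hp := h.1
    rw [List.Nodup, List.pairwise_map] at hp
    refine hp.imp ?_
    intro e f hef
    rw [Function.onFun, List.disjoint_left]
    rintro ⟨v, u, w⟩ h1 h2
    simp only [extend, List.mem_map, Prod.mk.injEq] at h1 h2
    obtain ⟨_, _, h1a, h1b, _⟩ := h1
    obtain ⟨_, _, h2a, h2b, _⟩ := h2
    apply hef
    rw [← orient_sym2 (key := key) e, ← orient_sym2 (key := key) f, h1a, h1b, h2a, h2b]

/-- A 4-cycle written from its node of largest key. -/
def IsTop (key : Fin n → ℕ) (q : Fin n × Fin n × Fin n × Fin n) : Prop :=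
  key q.2.1 < key q.1 ∧ key q.2.2.1 < key q.1 ∧ key q.2.2.2 < key q.1

theorem exists_isTop {q : Fin n × Fin n × Fin n × Fin n} (hkey : Function.Injective key)
    (hq : IsFourCycle G q) :
    ∃ q', IsFourCycle G q' ∧ IsTop key q' ∧ cycleEdges q' = cycleEdges q := by
  have rot : ∀ a b c d : Fin n, IsFourCycle G (a, b, c, d) → IsFourCycle G (b, c, d, a) ∧
      cycleEdges (b, c, d, a) = cycleEdges (a, b, c, d) := by
    rintro a b c d ⟨h1, h2, h3, h4, h5, h6⟩
    refine ⟨⟨h2, h3, h4, h1, h6, h5.symm⟩, ?_⟩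
    ext e
    simp only [cycleEdges, Finset.mem_insert, Finset.mem_singleton]
    tauto
  obtain ⟨a, b, c, d⟩ := q
  obtain ⟨k1, e1⟩ := rot a b c d hq
  obtain ⟨k2, e2⟩ := rot _ _ _ _ k1
  obtain ⟨k3, e3⟩ := rot _ _ _ _ k2
  obtain ⟨h1, h2, h3, h4, h5, h6⟩ := id hq
  have n1 := hkey.ne h1.ne
  have n2 := hkey.ne h2.ne
  have n3 := hkey.ne h3.ne
  have n4 := hkey.ne h4.ne
  have n5 := hkey.ne h5
  have n6 := hkey.ne h6
  by_cases ha : key b < key a ∧ key c < key a ∧ key d < key a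
  · exact ⟨_, hq, ha, rfl⟩
  by_cases hb : key c < key b ∧ key d < key b ∧ key a < key b
  · exact ⟨_, k1, hb, e1⟩
  by_cases hc : key d < key c ∧ key a < key c ∧ key b < key c
  · exact ⟨_, k2, hc, e2.trans e1⟩
  · refine ⟨_, k3, ?_, e3.trans (e2.trans e1)⟩
    simp only [IsTop]
    omega

/-- The top node is the largest key on any edge of the cycle, its two edges reveal the unordered
pair of middle nodes, and the other edge at a middle node reveals the opposite node. Only the order
of the two middle nodes stays undetermined. -/
theorem isTop_unique {v u w x v' u' w' x' : Fin n} (hq : IsTop key (v, u, w, x))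
    (hq' : IsTop key (v', u', w', x')) (hG : IsFourCycle G (v, u, w, x))
    (hG' : IsFourCycle G (v', u', w', x'))
    (h : cycleEdges (v, u, w, x) = cycleEdges (v', u', w', x')) :
    v = v' ∧ w = w' ∧ (u = u' ∧ x = x' ∨ u = x' ∧ x = u') := by
  have le : ∀ {v u w x v' u' w' x' : Fin n}, IsTop key (v', u', w', x') →
      cycleEdges (v, u, w, x) = cycleEdges (v', u', w', x') → key v ≤ key v' := by
    intro v u w x v' u' w' x' ht h
    have hm : s(v, u) ∈ cycleEdges (v', u', w', x') := by rw [← h]; simp [cycleEdges]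
    simp only [cycleEdges, Finset.mem_insert, Finset.mem_singleton, Sym2.eq_iff] at hm
    obtain ⟨h1, h2, h3⟩ := ht
    simp only at h1 h2 h3
    rcases hm with (⟨rfl, -⟩ | ⟨rfl, -⟩) | (⟨rfl, -⟩ | ⟨rfl, -⟩) | (⟨rfl, -⟩ | ⟨rfl, -⟩) |
      (⟨rfl, -⟩ | ⟨rfl, -⟩) <;> omega
  have star : ∀ {v u w x : Fin n}, IsTop key (v, u, w, x) →
      ∀ y, s(v, y) ∈ cycleEdges (v, u, w, x) ↔ y = u ∨ y = x := by
    intro v u w x ht y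
    obtain ⟨h1, h2, h3⟩ := ht
    simp only at h1 h2 h3
    have n1 : v ≠ u := by rintro rfl; omega
    have n2 : v ≠ w := by rintro rfl; omega
    have n3 : v ≠ x := by rintro rfl; omega
    simp [cycleEdges, n1, n2, n3]
  have hkk : key v = key v' := le_antisymm (le hq' h) (le hq h.symm)
  have hv : v = v' := by
    have hm : s(v, u) ∈ cycleEdges (v', u', w', x') := by rw [← h]; simp [cycleEdges]
    simp only [cycleEdges, Finset.mem_insert, Finset.mem_singleton, Sym2.eq_iff] at hm
    obtain ⟨h1, h2, h3⟩ := hq'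
    simp only at h1 h2 h3
    rcases hm with (⟨rfl, -⟩ | ⟨rfl, -⟩) | (⟨rfl, -⟩ | ⟨rfl, -⟩) | (⟨rfl, -⟩ | ⟨rfl, -⟩) |
      (⟨rfl, -⟩ | ⟨rfl, -⟩) <;> first | rfl | omega
  subst hv
  have hu : ∀ y, (y = u ∨ y = x) ↔ (y = u' ∨ y = x') := fun y => by
    rw [← star hq, ← star hq', h]
  have hux : u ≠ x := hG.2.2.2.2.2
  have hux' : u' ≠ x' := hG'.2.2.2.2.2
  have huu : u = u' ∧ x = x' ∨ u = x' ∧ x = u' := by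
    have a1 := (hu u).1 (Or.inl rfl)
    have a2 := (hu x).1 (Or.inr rfl)
    have a3 := (hu u').2 (Or.inl rfl)
    grind
  have hw : w = w' := by
    have hm : s(u, w) ∈ cycleEdges (v, u', w', x') := by rw [← h]; simp [cycleEdges]
    simp only [cycleEdges, Finset.mem_insert, Finset.mem_singleton, Sym2.eq_iff] at hm
    obtain ⟨h1, h2, h3⟩ := hq
    obtain ⟨h1', h2', h3'⟩ := hq'
    simp only at h1 h2 h3 h1' h2' h3'
    have n1 : v ≠ u := by rintro rfl; omega
    have n2 : v ≠ w := by rintro rfl; omega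
    have n3 := hG'.2.1.ne
    have n4 := hG'.2.2.1.ne
    grind
  exact ⟨rfl, hw, huu⟩

/-- Stated for any order of the paths, since the machine records them with the latest at the head.
-/
theorem IsEdgeList.listsFourCycles (h : IsEdgeList G edges) (hkey : Function.Injective key)
    {P : List (Fin n × Fin n × Fin n)} (hP : P.Perm (downPaths key (nbrs edges) edges)) :
    (∀ q ∈ pairUp P, IsFourCycle G q) ∧ ((pairUp P).map cycleEdges).Nodup ∧
      ∀ C ∈ fourCycles G, C ∈ (pairUp P).map cycleEdges := by
  have hnd : P.Nodup := hP.nodup_iff.2 h.nodup_downPaths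
  have hmem : ∀ v u w, (v, u, w) ∈ P ↔
      G.Adj v u ∧ G.Adj u w ∧ key u < key v ∧ key w < key v := fun v u w => by
    rw [hP.mem_iff, h.mem_downPaths hkey]
  have good : ∀ v u w x, (v, u, w) ∈ P → (v, x, w) ∈ P → u ≠ x →
      IsFourCycle G (v, u, w, x) ∧ IsTop key (v, u, w, x) := by
    intro v u w x h1 h2 hne
    rw [hmem] at h1 h2
    refine ⟨⟨h1.1, h1.2.1, h2.2.1.symm, h2.1.symm, ?_, hne⟩, h1.2.2.1, h1.2.2.2, h2.2.2.1⟩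
    rintro rfl
    exact lt_irrefl _ h1.2.2.2
  refine ⟨?_, ?_, ?_⟩
  · rintro ⟨v, u, w, x⟩ hq
    obtain ⟨h1, h2, h3⟩ := mem_pairUp hnd hq
    exact (good _ _ _ _ h1 h2 h3).1
  -- Induction along the recording. If a cycle of the new path equalled an older one, `isTop_unique`
  -- would make the new path one of the two older paths of that cycle.
  · have key_step : ∀ Q : List (Fin n × Fin n × Fin n), Q.Nodup → (∀ t ∈ Q, t ∈ P) →
        ((pairUp Q).map cycleEdges).Nodup := by
      intro Q hQ hQP
      induction Q with
      | nil => simp [pairUp]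
      | cons t Q ih =>
        obtain ⟨v, u, w⟩ := t
        have hQ' := List.nodup_cons.1 hQ
        have hsub : ∀ t ∈ Q, t ∈ P := fun t ht => hQP t (List.mem_cons_of_mem _ ht)
        have htP : (v, u, w) ∈ P := hQP _ List.mem_cons_self
        have hne : ∀ x, (v, x, w) ∈ Q → u ≠ x := by
          rintro x hx rfl
          exact hQ'.1 hx
        simp only [pairUp, List.map_append, List.map_map]
        refine List.Nodup.append (ih hQ'.2 hsub) ?_ ?_
        · refine List.Nodup.map_on ?_ (nodup_mids hQ'.2 v w)
          intro x hx y hy hxy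
          rw [mem_mids] at hx hy
          obtain ⟨gx, tx⟩ := good _ _ _ _ htP (hsub _ hx) (hne x hx)
          obtain ⟨gy, ty⟩ := good _ _ _ _ htP (hsub _ hy) (hne y hy)
          rcases (isTop_unique tx ty gx gy hxy).2.2 with h' | h'
          · exact h'.2
          · exact absurd h'.1 (hne y hy)
        · rw [List.disjoint_left]
          intro C h1 h2
          rw [List.mem_map] at h1 h2
          obtain ⟨⟨v', u', w', x'⟩, hm', rfl⟩ := h1
          obtain ⟨x, hx, hC⟩ := h2
          rw [mem_mids] at hx
          obtain ⟨m1, m2, m3⟩ := mem_pairUp hQ'.2 hm'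
          obtain ⟨gx, tx⟩ := good _ _ _ _ htP (hsub _ hx) (hne x hx)
          obtain ⟨gy, ty⟩ := good _ _ _ _ (hsub _ m1) (hsub _ m2) m3
          obtain ⟨rfl, rfl, ⟨rfl, rfl⟩ | ⟨rfl, rfl⟩⟩ := isTop_unique tx ty gx gy hC
          · exact hQ'.1 m1
          · exact hQ'.1 m2
    exact key_step P hnd fun _ => id
  · rintro C ⟨q, hq, rfl⟩
    obtain ⟨⟨v, u, w, x⟩, hq', ht, he⟩ := exists_isTop hkey hq
    obtain ⟨h1, h2, h3, h4, h5, h6⟩ := hq'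
    obtain ⟨t1, t2, t3⟩ := ht
    rw [← he]
    rcases pairUp_complete ((hmem v u w).2 ⟨h1, h2, t1, t2⟩)
      ((hmem v x w).2 ⟨h4.symm, h3.symm, t3, t2⟩) h6 with h' | h'
    · exact List.mem_map_of_mem h'
    · rw [List.mem_map]
      refine ⟨_, h', ?_⟩
      ext e
      simp only [cycleEdges, Finset.mem_insert, Finset.mem_singleton, Sym2.eq_swap (a := w),
        Sym2.eq_swap (b := v)]
      tauto

end Graph


/-! ### Bounding the sum of the smaller endpoint degrees. -/

section Counting

variable {n : ℕ} (G : SimpleGraph (Fin n))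

open Classical in
/-- The consecutive quadruples of nodes of 4-cycles; every 4-cycle gives several of them. -/
noncomputable def quads : Finset (Fin n × Fin n × Fin n × Fin n) :=
  Finset.univ.filter (IsFourCycle G)

/-- An edge set fixes at most four nodes, so at most `4 ^ 4 = 256` quadruples share it. -/
theorem card_quads_le : (quads G).card ≤ 256 * (fourCycles G).ncard := by
  classical
  have himg : fourCycles G = ↑((quads G).image cycleEdges) := by
    ext C
    rw [Finset.mem_coe, Finset.mem_image]
    simp only [quads, Finset.mem_filter, Finset.mem_univ, true_and]
    rfl
  rw [himg, Set.ncard_coe_finset]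
  apply Finset.card_le_mul_card_image
  intro C hC
  obtain ⟨⟨a, b, c, d⟩, -, rfl⟩ := Finset.mem_image.1 hC
  set S : Finset (Fin n) := {a, b, c, d} with hS
  have hcard : S.card ≤ 4 := Finset.card_le_four
  have hsub : (quads G).filter (fun q => cycleEdges q = cycleEdges (a, b, c, d)) ⊆
      S ×ˢ S ×ˢ S ×ˢ S := by
    rintro ⟨x, y, z, u⟩ hq
    have he := (Finset.mem_filter.1 hq).2
    have key : ∀ p q : Fin n, s(p, q) ∈ cycleEdges (x, y, z, u) → p ∈ S ∧ q ∈ S := by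
      intro p q hpq
      rw [he] at hpq
      simp only [cycleEdges, Finset.mem_insert, Finset.mem_singleton, Sym2.eq_iff] at hpq
      simp only [hS, Finset.mem_insert, Finset.mem_singleton]
      tauto
    have h1 := key x y (by simp [cycleEdges])
    have h2 := key z u (by simp [cycleEdges])
    simp [h1, h2]
  refine (Finset.card_le_card hsub).trans ?_
  simp only [Finset.card_product]
  calc S.card * (S.card * (S.card * S.card)) ≤ 4 * (4 * (4 * 4)) := by gcongr
    _ = 256 := by norm_num

open Classical in
/-- The adjacency indicator of the subgraph induced on `S`. -/
noncomputable def adjOn (S : Finset (Fin n)) (a b : Fin n) : ℕ :=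
  if G.Adj a b ∧ a ∈ S ∧ b ∈ S then 1 else 0

/-- The sum of the squared degrees of the subgraph induced on `S`. -/
noncomputable def sqDeg (S : Finset (Fin n)) : ℕ := ∑ v, (∑ a, adjOn G S v a) ^ 2

/-- The sum of the degrees of the subgraph induced on `S`. -/
noncomputable def sumDeg (S : Finset (Fin n)) : ℕ := ∑ v, ∑ a, adjOn G S v a

variable {G}

theorem adjOn_eq_zero {S : Finset (Fin n)} {a b : Fin n} (h : a ∉ S ∨ b ∉ S) :
    adjOn G S a b = 0 := by
  unfold adjOn
  rw [if_neg]
  tauto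

theorem adjOn_le_one (S : Finset (Fin n)) (a b : Fin n) : adjOn G S a b ≤ 1 := by
  unfold adjOn
  split_ifs <;> simp

theorem sumDeg_sq_le (S : Finset (Fin n)) : sumDeg G S ^ 2 ≤ S.card * sqDeg G S := by
  have h1 : sumDeg G S = ∑ v ∈ S, ∑ a, adjOn G S v a := by
    refine (Finset.sum_subset (Finset.subset_univ S) fun v _ hv => ?_).symm
    exact Finset.sum_eq_zero fun a _ => adjOn_eq_zero (Or.inl hv)
  rw [h1]
  refine sq_sum_le_card_mul_sum_sq.trans (Nat.mul_le_mul_left _ ?_)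
  exact Finset.sum_le_sum_of_subset (Finset.subset_univ S)

theorem sqDeg_eq (S : Finset (Fin n)) :
    sqDeg G S = ∑ a, ∑ c, ∑ v, adjOn G S v a * adjOn G S v c := by
  unfold sqDeg
  simp_rw [sq, Finset.sum_mul_sum]
  rw [Finset.sum_comm]
  exact Finset.sum_congr rfl fun a _ => Finset.sum_comm

/-- The squared degrees sum to the codegrees of all pairs in `S × S`, and Cauchy-Schwarz brings in
the squared codegrees. These count closed walks `a, b, c, d`: genuine 4-cycles, or walks with `a =
c` or `b = d`, each degenerate kind contributing `sqDeg`. -/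
theorem sqDeg_sq_le (S : Finset (Fin n)) :
    sqDeg G S ^ 2 ≤ S.card ^ 2 * ((quads G).card + 2 * sqDeg G S) := by
  classical
  set f := adjOn G S with hf
  have h1 : sqDeg G S = ∑ p ∈ S ×ˢ S, ∑ v, f v p.1 * f v p.2 := by
    rw [sqDeg_eq, ← Finset.sum_product', Finset.univ_product_univ]
    refine (Finset.sum_subset (Finset.subset_univ (S ×ˢ S)) fun p _ hp => ?_).symm
    refine Finset.sum_eq_zero fun v _ => ?_
    rw [Finset.mem_product, not_and_or] at hp
    rcases hp with hp | hp
    · rw [adjOn_eq_zero (Or.inr hp), zero_mul]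
    · rw [adjOn_eq_zero (b := p.2) (Or.inr hp), mul_zero]
  have h2 : ∑ p ∈ S ×ˢ S, (∑ v, f v p.1 * f v p.2) ^ 2 ≤ (quads G).card + 2 * sqDeg G S := by
    calc ∑ p ∈ S ×ˢ S, (∑ v, f v p.1 * f v p.2) ^ 2
        ≤ ∑ p : Fin n × Fin n, (∑ v, f v p.1 * f v p.2) ^ 2 :=
          Finset.sum_le_sum_of_subset (Finset.subset_univ _)
      _ = ∑ a, ∑ c, ∑ b, ∑ d, f b a * f b c * (f d a * f d c) := by
          rw [Fintype.sum_prod_type]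
          simp_rw [sq, Finset.sum_mul_sum]
      _ ≤ ∑ a, ∑ c, ∑ b, ∑ d, ((if IsFourCycle G (a, b, c, d) then 1 else 0) +
            ((if a = c then f b a * f d a else 0) + if b = d then f b a * f b c else 0)) := by
          refine Finset.sum_le_sum fun a _ => Finset.sum_le_sum fun c _ =>
            Finset.sum_le_sum fun b _ => Finset.sum_le_sum fun d _ => ?_
          have ha : ∀ x y, f x y = 1 ∧ G.Adj x y ∨ f x y = 0 := by
            intro x y
            simp only [hf, adjOn]
            split_ifs with h
            · exact Or.inl ⟨rfl, h.1⟩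
            · exact Or.inr rfl
          rcases ha b a with ⟨e1, g1⟩ | e1
          swap
          · simp [e1]
          rcases ha b c with ⟨e2, g2⟩ | e2
          swap
          · simp [e2]
          rcases ha d a with ⟨e3, g3⟩ | e3
          swap
          · simp [e3]
          rcases ha d c with ⟨e4, g4⟩ | e4
          swap
          · simp [e4]
          rw [e1, e2, e3, e4]
          by_cases hac : a = c
          · rw [if_pos hac]; omega
          by_cases hbd : b = d
          · rw [if_pos hbd]; omega
          rw [if_pos ⟨g1.symm, g2, g4.symm, g3, hac, hbd⟩]
          omega
      _ = (quads G).card + 2 * sqDeg G S := by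
          simp only [Finset.sum_add_distrib]
          rw [two_mul]
          congr 1
          · rw [quads, Finset.card_filter, Fintype.sum_prod_type]
            refine Finset.sum_congr rfl fun a _ => ?_
            rw [Finset.sum_comm, Fintype.sum_prod_type]
            refine Finset.sum_congr rfl fun b _ => ?_
            rw [Fintype.sum_prod_type]
          · congr 1
            · rw [sqDeg, Finset.sum_comm]
              simp_rw [sq, Finset.sum_mul_sum]
              have : ∀ a c b, (∑ d, if a = c then f b a * f d a else 0) =
                  if a = c then ∑ d, f b a * f d a else 0 := by
                intro a c b; split_ifs <;> simp
              simp_rw [this]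
              have : ∀ a c, (∑ b, if a = c then ∑ d, f b a * f d a else 0) =
                  if a = c then ∑ b, ∑ d, f b a * f d a else 0 := by
                intro a c; split_ifs <;> simp
              simp_rw [this, Finset.sum_ite_eq', Finset.mem_univ, if_true]
              refine Finset.sum_congr rfl fun a _ => Finset.sum_congr rfl fun b _ =>
                Finset.sum_congr rfl fun d _ => ?_
              simp only [hf, adjOn, G.adj_comm a, and_comm]
            · simp_rw [Finset.sum_ite_eq, Finset.mem_univ, if_true]
              exact (sqDeg_eq S).symm
  rw [h1]
  refine sq_sum_le_card_mul_sum_sq.trans ?_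
  rw [Finset.card_product, ← sq, ← h1]
  exact Nat.mul_le_mul_left _ h2

/-- If this failed, both terms on the right of `sqDeg_sq_le` would be too small: `2X` times `|S|²`
is below `X² / 2`, and the cycle term is below `X² / 4`. -/
theorem sqDeg_le (S : Finset (Fin n)) : sqDeg G S ≤ 4 * S.card ^ 2 + (quads G).card := by
  have h := sqDeg_sq_le (G := G) S
  by_contra! hlt
  nlinarith [Nat.zero_le (S.card ^ 2), Nat.zero_le (quads G).card,
    Nat.mul_le_mul_left (S.card ^ 2) hlt.le]

/-- Here `μ` stands for the cube root of the number of edges, `D` for a degree threshold, and `N, E,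
X` for the size, degree sum and squared degree sum of the induced subgraph above it; `H` counts
labelled 4-cycles. -/
theorem mul_sumDeg_bound {μ D N E X H : ℝ} (hμ : 0 ≤ μ) (hD : 0 ≤ D) (hN : 0 ≤ N) (hE : 0 ≤ E)
    (hX : 0 ≤ X) (hH : 0 ≤ H) (h1 : N * D ≤ 2 * μ ^ 3) (h2 : E ≤ 2 * μ ^ 3)
    (h3 : E ^ 2 ≤ N * X) (h4 : X ^ 2 ≤ N ^ 2 * (H + 2 * X)) : D * E ≤ 6 * (μ ^ 4 + H) := by
  have hμ4 : 0 ≤ μ ^ 4 := by positivity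
  rcases lt_or_ge D μ with hlt | hge
  · have : D * E ≤ μ * (2 * μ ^ 3) := by gcongr
    nlinarith
  rcases hμ.eq_or_lt with rfl | hpos
  · have : E = 0 := le_antisymm (by simpa using h2) hE
    simp [this, hH]
  have hND : (N * D) ^ 3 ≤ (2 * μ ^ 3) ^ 3 := by gcongr
  have hND4 : (N * D) ^ 4 ≤ (2 * μ ^ 3) ^ 4 := by gcongr
  rcases le_or_gt X (4 * N ^ 2) with hX4 | hX4
  -- With few two-step walks, `E² ≤ 4 N³`; the spare factor `D ≥ μ` turns `(N D)³` into a bound on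
  -- `(D E)²`.
  · have e1 : E ^ 2 ≤ N * (4 * N ^ 2) := h3.trans (by gcongr)
    have e2 : (D * E) ^ 2 * μ ≤ 32 * μ ^ 8 * μ := by
      calc (D * E) ^ 2 * μ ≤ (D * E) ^ 2 * D := by gcongr
        _ = D ^ 3 * E ^ 2 := by ring
        _ ≤ D ^ 3 * (N * (4 * N ^ 2)) := by gcongr
        _ = 4 * (N * D) ^ 3 := by ring
        _ ≤ 4 * (2 * μ ^ 3) ^ 3 := by gcongr
        _ = 32 * μ ^ 8 * μ := by ring
    have e3 : (D * E) ^ 2 ≤ 32 * μ ^ 8 := le_of_mul_le_mul_right e2 hpos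
    have e4 : (D * E) ^ 2 ≤ (6 * μ ^ 4) ^ 2 := e3.trans (by nlinarith [pow_pos hpos 8])
    have e5 := le_of_pow_le_pow_left₀ two_ne_zero (by positivity) e4
    linarith
  -- With many two-step walks, the degenerate term `2 N² X` is below `X² / 2` and is absorbed, so
  -- the 4-cycles dominate.
  · have e1 : X ^ 2 ≤ 2 * N ^ 2 * H := by nlinarith
    have e2 : E ^ 4 ≤ 2 * N ^ 4 * H := by
      calc E ^ 4 = (E ^ 2) ^ 2 := by ring
        _ ≤ (N * X) ^ 2 := by gcongr
        _ = N ^ 2 * X ^ 2 := by ring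
        _ ≤ N ^ 2 * (2 * N ^ 2 * H) := by gcongr
        _ = 2 * N ^ 4 * H := by ring
    have e3 : (D * E) ^ 4 ≤ (6 * (μ ^ 4 + H)) ^ 4 := by
      calc (D * E) ^ 4 = D ^ 4 * E ^ 4 := by ring
        _ ≤ D ^ 4 * (2 * N ^ 4 * H) := by gcongr
        _ = 2 * (N * D) ^ 4 * H := by ring
        _ ≤ 2 * (2 * μ ^ 3) ^ 4 * H := by gcongr
        _ = 32 * (μ ^ 4) ^ 3 * H := by ring
        _ ≤ 32 * (μ ^ 4 + H) ^ 3 * (μ ^ 4 + H) := by gcongr <;> linarith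
        _ ≤ (6 * (μ ^ 4 + H)) ^ 4 := by
          have : 0 ≤ (μ ^ 4 + H) ^ 4 := by positivity
          nlinarith
    exact le_of_pow_le_pow_left₀ (by norm_num) (by positivity) e3

open Classical in
/-- The sum of the smaller degree of the two endpoints, over all directed edges. -/
noncomputable def sumMinDeg (G : SimpleGraph (Fin n)) : ℕ :=
  ∑ a, ∑ b, if G.Adj a b then min (G.degree a) (G.degree b) else 0

theorem sum_adjOn_univ [DecidableRel G.Adj] (a : Fin n) :
    ∑ b, adjOn G Finset.univ a b = G.degree a := by
  simp [adjOn, ← SimpleGraph.card_neighborFinset_eq_degree, SimpleGraph.neighborFinset_eq_filter]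

/-- Replacing the minimum by the degree of the first node gives the sum of squared degrees. -/
theorem sumMinDeg_le_sq : sumMinDeg G ≤ 4 * n ^ 2 + (quads G).card := by
  classical
  have h : sumMinDeg G ≤ sqDeg G Finset.univ := by
    refine Finset.sum_le_sum fun a _ => ?_
    rw [sq, ← sum_adjOn_univ (G := G) a, Finset.sum_mul]
    refine Finset.sum_le_sum fun b _ => ?_
    simp only [adjOn, Finset.mem_univ, and_self, and_true]
    split_ifs
    · rw [one_mul]
      exact min_le_left _ _
    · simp
  simpa using h.trans (sqDeg_le Finset.univ)

/-- Layer-cake formula: a minimum counts the thresholds `D ≥ 1` that both degrees reach. Degrees are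
below `n`, so thresholds up to `n` suffice. -/
theorem sumMinDeg_eq [DecidableRel G.Adj] :
    sumMinDeg G = ∑ D ∈ Finset.Icc 1 n, sumDeg G (Finset.univ.filter fun v => D ≤ G.degree v) := by
  classical
  unfold sumMinDeg sumDeg
  rw [Finset.sum_comm]
  rw [Finset.sum_comm (s := Finset.Icc 1 n)]
  rw [Finset.sum_comm]
  refine Finset.sum_congr rfl fun a _ => ?_
  rw [Finset.sum_comm (s := Finset.Icc 1 n)]
  refine Finset.sum_congr rfl fun b _ => ?_
  by_cases hab : G.Adj a b
  · simp only [adjOn, hab, if_true, true_and, Finset.mem_filter, Finset.mem_univ]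
    rw [← Finset.card_filter]
    have hset : (Finset.Icc 1 n).filter (fun D => D ≤ G.degree a ∧ D ≤ G.degree b) =
        Finset.Icc 1 (min (G.degree a) (G.degree b)) := by
      ext D
      have := (G.degree_lt_card_verts a).le
      rw [Fintype.card_fin] at this
      simp only [Finset.mem_filter, Finset.mem_Icc, le_min_iff]
      constructor
      · rintro ⟨⟨h1, h2⟩, h3⟩
        exact ⟨h1, h3⟩
      · rintro ⟨h1, h3⟩
        exact ⟨⟨h1, h3.1.trans this⟩, h3⟩
    rw [hset, Nat.card_Icc, Nat.add_sub_cancel]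
    congr!
  · simp [adjOn, hab]

theorem sumDeg_le [DecidableRel G.Adj] (S : Finset (Fin n)) : sumDeg G S ≤ ∑ v, G.degree v := by
  refine Finset.sum_le_sum fun v _ => ?_
  rw [← sum_adjOn_univ]
  refine Finset.sum_le_sum fun a _ => ?_
  by_cases h : G.Adj v a
  · simpa [adjOn, h] using adjOn_le_one (G := G) S v a
  · simp [adjOn, h]

theorem sumMinDeg_le_log : (sumMinDeg G : ℝ) ≤
    6 * (((G.edgeSet.ncard : ℕ) : ℝ) ^ ((4 : ℝ) / 3) + (quads G).card) * (1 + Real.log n) := by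
  classical
  set m : ℕ := G.edgeSet.ncard with hm
  have hdeg : ∑ v, G.degree v = 2 * m := by
    rw [hm, G.sum_degrees_eq_twice_card_edges, ← SimpleGraph.coe_edgeFinset, Set.ncard_coe_finset]
  set μ : ℝ := (m : ℝ) ^ ((1 : ℝ) / 3) with hμ
  have hμ3 : μ ^ 3 = m := by
    rw [hμ, ← Real.rpow_natCast, ← Real.rpow_mul (Nat.cast_nonneg _)]
    norm_num
  have hμ4 : μ ^ 4 = (m : ℝ) ^ ((4 : ℝ) / 3) := by
    rw [hμ, ← Real.rpow_natCast, ← Real.rpow_mul (Nat.cast_nonneg _)]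
    norm_num
  have hμ0 : 0 ≤ μ := by positivity
  rw [← hμ4]
  have hM : 0 ≤ 6 * (μ ^ 4 + ((quads G).card : ℝ)) := by positivity
  have hlevel : ∀ D ∈ Finset.Icc 1 n,
      ((sumDeg G (Finset.univ.filter fun v => D ≤ G.degree v) : ℕ) : ℝ) ≤
        6 * (μ ^ 4 + (quads G).card) * (D : ℝ)⁻¹ := by
    intro D hD
    have hD0 : (0 : ℝ) < D := by exact_mod_cast (Finset.mem_Icc.1 hD).1
    rw [← div_eq_mul_inv, le_div_iff₀ hD0, mul_comm]
    set S := Finset.univ.filter fun v => D ≤ G.degree v with hS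
    have c1 : S.card * D ≤ 2 * m := by
      rw [← hdeg, ← smul_eq_mul]
      refine (Finset.card_nsmul_le_sum S (fun v => G.degree v) D fun v hv => ?_).trans
        (Finset.sum_le_sum_of_subset (Finset.subset_univ S))
      exact (Finset.mem_filter.1 hv).2
    have c2 : sumDeg G S ≤ 2 * m := hdeg ▸ sumDeg_le S
    refine mul_sumDeg_bound (N := S.card) (X := sqDeg G S) hμ0 hD0.le (Nat.cast_nonneg _)
      (Nat.cast_nonneg _) (Nat.cast_nonneg _) (Nat.cast_nonneg _) ?_ ?_ ?_ ?_
    · rw [hμ3]; exact_mod_cast c1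
    · rw [hμ3]; exact_mod_cast c2
    · exact_mod_cast sumDeg_sq_le S
    · exact_mod_cast sqDeg_sq_le S
  have hharm : ∑ D ∈ Finset.Icc 1 n, (D : ℝ)⁻¹ ≤ 1 + Real.log n := by
    have := harmonic_le_one_add_log n
    rw [harmonic_eq_sum_Icc] at this
    push_cast at this
    exact this
  calc (sumMinDeg G : ℝ) = ∑ D ∈ Finset.Icc 1 n,
        ((sumDeg G (Finset.univ.filter fun v => D ≤ G.degree v) : ℕ) : ℝ) := by
        rw [sumMinDeg_eq]; push_cast; rfl
    _ ≤ ∑ D ∈ Finset.Icc 1 n, 6 * (μ ^ 4 + (quads G).card) * (D : ℝ)⁻¹ :=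
        Finset.sum_le_sum hlevel
    _ = 6 * (μ ^ 4 + (quads G).card) * ∑ D ∈ Finset.Icc 1 n, (D : ℝ)⁻¹ := by
        rw [Finset.mul_sum]
    _ ≤ _ := by gcongr

theorem IsEdgeList.length_eq {edges : List (Fin n × Fin n)} (h : IsEdgeList G edges) :
    edges.length = G.edgeSet.ncard := by
  classical
  have : G.edgeSet = ↑(edges.map fun e => s(e.1, e.2)).toFinset := by
    ext e
    rw [h.2 e]
    simp
  rw [this, Set.ncard_coe_finset, List.toFinset_card_of_nodup h.1, List.length_map]

theorem IsEdgeList.sum_le_sumMinDeg {edges : List (Fin n × Fin n)} (h : IsEdgeList G edges) :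
    (edges.map fun e => min (nbrs edges e.1).length (nbrs edges e.2).length).sum ≤
      sumMinDeg G := by
  classical
  simp_rw [h.length_nbrs]
  have hnd : edges.Nodup := List.Nodup.of_map _ h.1
  rw [← List.sum_toFinset _ hnd, sumMinDeg, ← Fintype.sum_prod_type' (f := fun a b =>
    if G.Adj a b then min (G.degree a) (G.degree b) else 0), ← Finset.sum_filter]
  refine Finset.sum_le_sum_of_subset fun e he => ?_
  rw [Finset.mem_filter]
  exact ⟨Finset.mem_univ _, h.adj_of_mem (List.mem_toFinset.1 he)⟩

end Counting

end FourCycle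

/-! ### A weakest-precondition calculus with running time. -/

namespace WordRAM

/-- `s` with the value `v` in register `d`. -/
def State.upd (s : State) (d v : ℕ) : State := { s with reg := Function.update s.reg d v }

/-- `s` with the value `v` in memory cell `a`. -/
def State.write (s : State) (a v : ℕ) : State := { s with mem := Function.update s.mem a v }

/-- `s` after printing `v`. -/
def State.emit (s : State) (v : ℕ) : State := { s with out := s.out ++ [v] }

section StateLemmas

variable (s : State) (d v a r : ℕ)

@[simp] theorem State.upd_reg : (s.upd d v).reg r = if r = d then v else s.reg r := by
  simp [State.upd, Function.update_apply]

@[simp] theorem State.upd_mem : (s.upd d v).mem = s.mem := rfl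

@[simp] theorem State.upd_out : (s.upd d v).out = s.out := rfl

@[simp] theorem State.upd_upd (u : ℕ) : (s.upd d v).upd d u = s.upd d u := by
  simp [State.upd]

@[simp] theorem State.write_reg : (s.write a v).reg = s.reg := rfl

@[simp] theorem State.write_mem : (s.write a v).mem = Function.update s.mem a v := rfl

@[simp] theorem State.write_out : (s.write a v).out = s.out := rfl

@[simp] theorem State.emit_reg : (s.emit v).reg = s.reg := rfl

@[simp] theorem State.emit_mem : (s.emit v).mem = s.mem := rfl

@[simp] theorem State.emit_out : (s.emit v).out = s.out ++ [v] := rfl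

theorem State.setReg_eq_upd {w : ℕ} (h : v < 2 ^ w) : s.setReg w d v = s.upd d v := by
  simp [State.setReg, State.upd, Nat.mod_eq_of_lt h]

end StateLemmas

/-- Program `p` started in `s` halts after some time `T` in some state `s'` with `Q s' T`. -/
def wp (w : ℕ) (p : Prog) (Q : State → ℕ → Prop) (s : State) : Prop :=
  ∃ s' T, Exec w p s s' T ∧ Q s' T

section Rules

variable {w : ℕ} {Q : State → ℕ → Prop} {s : State}

theorem wp_skip (h : Q s 1) : wp w .skip Q s := ⟨_, _, .skip s, h⟩

theorem wp_const {d k : ℕ} (hk : k < 2 ^ w) (h : Q (s.upd d k) 1) : wp w (.const d k) Q s :=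
  ⟨_, _, .const s d k, by rwa [State.setReg_eq_upd _ _ _ hk]⟩

/-- In this and the next rules, operand values enter through equations, so the new state is an
explicit term for `simp`; the bound on the result removes the reduction modulo `2 ^ w`. -/
theorem wp_copy {d x v : ℕ} (hx : s.reg x = v) (hv : v < 2 ^ w) (h : Q (s.upd d v) 1) :
    wp w (.copy d x) Q s :=
  ⟨_, _, .copy s d x, by rwa [hx, State.setReg_eq_upd _ _ _ hv]⟩

theorem wp_add {d x y a b : ℕ} (hx : s.reg x = a) (hy : s.reg y = b) (hv : a + b < 2 ^ w)
    (h : Q (s.upd d (a + b)) 1) : wp w (.add d x y) Q s :=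
  ⟨_, _, .add s d x y, by rwa [hx, hy, State.setReg_eq_upd _ _ _ hv]⟩

theorem wp_mul {d x y a b : ℕ} (hx : s.reg x = a) (hy : s.reg y = b) (hv : a * b < 2 ^ w)
    (h : Q (s.upd d (a * b)) 1) : wp w (.mul d x y) Q s :=
  ⟨_, _, .mul s d x y, by rwa [hx, hy, State.setReg_eq_upd _ _ _ hv]⟩

theorem wp_load {d a A v : ℕ} (ha : s.reg a = A) (hm : s.mem A = v) (hv : v < 2 ^ w)
    (h : Q (s.upd d v) 1) : wp w (.load d a) Q s :=
  ⟨_, _, .load s d a, by rwa [ha, hm, State.setReg_eq_upd _ _ _ hv]⟩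

theorem wp_store {a x A v : ℕ} (ha : s.reg a = A) (hx : s.reg x = v) (h : Q (s.write A v) 1) :
    wp w (.store a x) Q s :=
  ⟨_, _, .store s a x, by rw [ha, hx]; exact h⟩

theorem wp_print {x v : ℕ} (hx : s.reg x = v) (h : Q (s.emit v) 1) : wp w (.print x) Q s :=
  ⟨_, _, .print s x, by rw [hx]; exact h⟩

theorem wp_seq {p q : Prog} (h : wp w p (fun s₁ T₁ => wp w q (fun s₂ T₂ => Q s₂ (T₁ + T₂)) s₁) s) :
    wp w (.seq p q) Q s := by
  obtain ⟨s₁, T₁, e₁, s₂, T₂, e₂, hQ⟩ := h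
  exact ⟨s₂, _, .seq e₁ e₂, hQ⟩

theorem wp_ite_pos {b : Test} {p q : Prog} (hb : b.holds s)
    (h : wp w p (fun s' T => Q s' (T + 1)) s) : wp w (.ite b p q) Q s := by
  obtain ⟨s', T, e, hQ⟩ := h
  exact ⟨s', _, .ite_true hb e, hQ⟩

theorem wp_ite_neg {b : Test} {p q : Prog} (hb : ¬ b.holds s)
    (h : wp w q (fun s' T => Q s' (T + 1)) s) : wp w (.ite b p q) Q s := by
  obtain ⟨s', T, e, hQ⟩ := h
  exact ⟨s', _, .ite_false hb e, hQ⟩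

/-- A loop that handles the elements of a list one by one. `I l₁ s τ` holds when the elements of
`l₁` have been handled, in time `τ`. -/
theorem wp_for {α : Type*} {b : Test} {p : Prog} (l : List α) (I : List α → State → ℕ → Prop)
    (h0 : I [] s 0)
    (hb : ∀ l₁ x l₂ s τ, l = l₁ ++ x :: l₂ → I l₁ s τ → b.holds s)
    (he : ∀ s τ, I l s τ → ¬ b.holds s)
    (body : ∀ l₁ x l₂ s τ, l = l₁ ++ x :: l₂ → I l₁ s τ →
      wp w p (fun s' t => I (l₁ ++ [x]) s' (τ + t + 1)) s)
    (hQ : ∀ s' τ, I l s' τ → Q s' (τ + 1)) : wp w (.loop b p) Q s := by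
  -- `T` leaves out the final failing test, so that times of successive iterations simply add.
  have key : ∀ l₂ l₁ s τ, l = l₁ ++ l₂ → I l₁ s τ →
      ∃ s' T, Exec w (.loop b p) s s' (T + 1) ∧ I l s' (τ + T) := by
    intro l₂
    induction l₂ with
    | nil =>
      intro l₁ s τ hl hI
      rw [List.append_nil] at hl
      subst hl
      exact ⟨s, 0, .loop_done (he s τ hI), hI⟩
    | cons x l₂ ih =>
      intro l₁ s τ hl hI
      obtain ⟨s₁, t, e₁, hI₁⟩ := body l₁ x l₂ s τ hl hI
      obtain ⟨s', T, e₂, hI'⟩ := ih (l₁ ++ [x]) s₁ _ (by simpa using hl) hI₁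
      refine ⟨s', t + (T + 1), .loop_step (hb l₁ x l₂ s τ hl hI) e₁ e₂, ?_⟩
      convert hI' using 1
      omega
  obtain ⟨s', T, e, hI⟩ := key l [] s 0 rfl h0
  refine ⟨s', _, e, hQ s' T ?_⟩
  simpa using hI

end Rules

/-! ### Memory layout: the input and the stacks. -/

/-- The address with digits `t, x, y, z` in base `B`. -/
def addr (B t x y z : ℕ) : ℕ := ((t * B + x) * B + y) * B + z

theorem addr_lt {B t x y z : ℕ} (ht : t ≤ 4) (hx : x < B) (hy : y < B) (hz : z < B) :
    addr B t x y z < 5 * B ^ 3 := by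
  unfold addr
  have h1 : t * B + x + 1 ≤ 5 * B := by nlinarith
  have h2 : (t * B + x) * B + y + 1 ≤ 5 * B * B := by nlinarith
  have h3 : ((t * B + x) * B + y) * B + z + 1 ≤ 5 * B * B * B := by nlinarith
  calc _ < 5 * B * B * B := h3
    _ = 5 * B ^ 3 := by ring

/-- Cells with leading digit zero are thus left to the input. -/
theorem le_addr {B t x y z : ℕ} (ht : 1 ≤ t) : B ^ 3 ≤ addr B t x y z := by
  unfold addr
  calc B ^ 3 = ((1 * B + 0) * B + 0) * B + 0 := by ring
    _ ≤ _ := by gcongr <;> omega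

theorem digit_inj {B a b x y : ℕ} (hx : x < B) (hy : y < B) :
    a * B + x = b * B + y ↔ a = b ∧ x = y := by
  constructor
  · intro h
    have h1 : x = y := by
      have := congrArg (· % B) h
      simpa [Nat.mod_eq_of_lt hx, Nat.mod_eq_of_lt hy] using this
    subst h1
    exact ⟨Nat.eq_of_mul_eq_mul_right (by omega) (Nat.add_right_cancel h), rfl⟩
  · rintro ⟨rfl, rfl⟩
    rfl

theorem addr_inj {B t x y z t' x' y' z' : ℕ} (hx : x < B) (hy : y < B) (hz : z < B)
    (hx' : x' < B) (hy' : y' < B) (hz' : z' < B) :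
    addr B t x y z = addr B t' x' y' z' ↔ t = t' ∧ x = x' ∧ y = y' ∧ z = z' := by
  unfold addr
  rw [digit_inj hz hz', digit_inj hy hy', digit_inj hx hx']
  tauto

/-- Register `14` gets the address with digits `t` and the contents of `x, y, z`, in the base
stored in register `0`. -/
def setAddr (t x y z : ℕ) : Prog :=
  .seq (.const 14 t) <| .seq (.mul 14 14 0) <| .seq (.add 14 14 x) <| .seq (.mul 14 14 0) <|
  .seq (.add 14 14 y) <| .seq (.mul 14 14 0) <| .add 14 14 z

/-- Register `d` gets the content of the table cell `t, x, y, z`. -/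
def fetch (d t x y z : ℕ) : Prog := .seq (setAddr t x y z) (.load d 14)

/-- The table cell `t, x, y, z` gets the content of register `v`. -/
def put (t x y z v : ℕ) : Prog := .seq (setAddr t x y z) (.store 14 v)

section Macros

variable {w B : ℕ} {Q : State → ℕ → Prop} {s : State} {t x y z X Y Z : ℕ}

/-- Horner's scheme only increases its intermediate values, so the bound on the final address
excludes every overflow. -/
theorem wp_setAddr (hW : 5 * B ^ 3 ≤ 2 ^ w) (ht : t ≤ 4) (hB : s.reg 0 = B)
    (hx : s.reg x = X) (hy : s.reg y = Y) (hz : s.reg z = Z) (hx' : x ≠ 14) (hy' : y ≠ 14)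
    (hz' : z ≠ 14) (hX : X < B) (hY : Y < B) (hZ : Z < B)
    (h : Q (s.upd 14 (addr B t X Y Z)) 7) : wp w (setAddr t x y z) Q s := by
  have hlt := (addr_lt ht hX hY hZ).trans_le hW
  have hpos : 0 < B := by omega
  unfold addr at hlt
  have l1 : ∀ a, a ≤ a * B := fun a => Nat.le_mul_of_pos_right a hpos
  have b1 := l1 t
  have b2 := l1 (t * B + X)
  have b3 := l1 ((t * B + X) * B + Y)
  have c1 : (t * B + X) * B + Y < 2 ^ w := by omega
  have c2 : (t * B + X) * B < 2 ^ w := by omega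
  have c3 : t * B + X < 2 ^ w := by omega
  have c4 : t * B < 2 ^ w := by omega
  refine wp_seq (wp_const (by omega) ?_)
  refine wp_seq (wp_mul (a := t) (b := B) (by simp) (by simpa using hB) c4 ?_)
  refine wp_seq (wp_add (a := t * B) (b := X) (by simp) (by simpa [hx'] using hx) c3 ?_)
  refine wp_seq (wp_mul (a := t * B + X) (b := B) (by simp) (by simpa using hB) c2 ?_)
  refine wp_seq (wp_add (a := (t * B + X) * B) (b := Y) (by simp) (by simpa [hy'] using hy) c1 ?_)
  refine wp_seq (wp_mul (a := (t * B + X) * B + Y) (b := B) (by simp) (by simpa using hB)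
    (by omega) ?_)
  refine wp_add (a := ((t * B + X) * B + Y) * B) (b := Z) (by simp) (by simpa [hz'] using hz) hlt ?_
  simpa [addr] using h

theorem wp_fetch {d V : ℕ} (hW : 5 * B ^ 3 ≤ 2 ^ w) (ht : t ≤ 4) (hB : s.reg 0 = B)
    (hx : s.reg x = X) (hy : s.reg y = Y) (hz : s.reg z = Z) (hx' : x ≠ 14) (hy' : y ≠ 14)
    (hz' : z ≠ 14) (hX : X < B) (hY : Y < B) (hZ : Z < B)
    (hm : s.mem (addr B t X Y Z) = V) (hV : V < 2 ^ w)
    (h : Q ((s.upd 14 (addr B t X Y Z)).upd d V) 8) : wp w (fetch d t x y z) Q s := by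
  refine wp_seq (wp_setAddr hW ht hB hx hy hz hx' hy' hz' hX hY hZ ?_)
  exact wp_load (by simp) hm hV h

theorem wp_put {v V : ℕ} (hW : 5 * B ^ 3 ≤ 2 ^ w) (ht : t ≤ 4) (hB : s.reg 0 = B)
    (hx : s.reg x = X) (hy : s.reg y = Y) (hz : s.reg z = Z) (hx' : x ≠ 14) (hy' : y ≠ 14)
    (hz' : z ≠ 14) (hX : X < B) (hY : Y < B) (hZ : Z < B) (hv : s.reg v = V) (hv' : v ≠ 14)
    (h : Q ((s.upd 14 (addr B t X Y Z)).write (addr B t X Y Z) V) 8) :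
    wp w (put t x y z v) Q s := by
  refine wp_seq (wp_setAddr hW ht hB hx hy hz hx' hy' hz' hX hY hZ ?_)
  exact wp_store (by simp) (by simpa [hv'] using hv) h

end Macros

/-- The memory holds the input, and for all `k, x, y` a stack with the entries `stk k x y`. -/
structure Stacks (n : ℕ) (inp : List ℕ) (mem : ℕ → ℕ)
    (stk : ℕ → Fin n → Fin n → List (Fin n)) : Prop where
  input : ∀ i < (n + 2) ^ 3, mem i = inp.getD i 0
  count : ∀ (k : ℕ) (x y : Fin n), mem (addr (n + 2) (2 * k + 1) x y 0) = (stk k x y).length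
  entry : ∀ (k : ℕ) (x y : Fin n) (i : ℕ) (h : i < (stk k x y).length),
    mem (addr (n + 2) (2 * k + 2) x y i) = ((stk k x y)[i] : ℕ)
  len : ∀ k x y, (stk k x y).length < n + 2

/-- Push `v` on the stack `k, x, y`. -/
def pushStk {n : ℕ} (stk : ℕ → Fin n → Fin n → List (Fin n)) (k : ℕ) (x y v : Fin n) :
    ℕ → Fin n → Fin n → List (Fin n) :=
  fun k' x' y' => if k' = k ∧ x' = x ∧ y' = y then stk k x y ++ [v] else stk k' x' y'

/-- Distinct digits give distinct addresses, so the two writes touch no other stack and no input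
cell. The base `n + 2` leaves room for a push onto a stack of length `n`. -/
theorem Stacks.push {n : ℕ} {inp : List ℕ} {mem : ℕ → ℕ}
    {stk : ℕ → Fin n → Fin n → List (Fin n)} (h : Stacks n inp mem stk) {k : ℕ} {x y : Fin n}
    (v : Fin n) (hlen : (stk k x y).length ≤ n) :
    Stacks n inp (Function.update
      (Function.update mem (addr (n + 2) (2 * k + 2) x y (stk k x y).length) v)
      (addr (n + 2) (2 * k + 1) x y 0) ((stk k x y).length + 1)) (pushStk stk k x y v) := by
  have lt : ∀ a : Fin n, (a : ℕ) < n + 2 := fun a => by omega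
  have l1 := h.len k x y
  constructor
  · intro i hi
    rw [Function.update_of_ne, Function.update_of_ne, h.input i hi]
    · exact (hi.trans_le (le_addr (by omega))).ne
    · exact (hi.trans_le (le_addr (by omega))).ne
  · intro k' x' y'
    simp only [Function.update_apply, addr_inj (lt x') (lt y') (by omega : 0 < n + 2) (lt x) (lt y)
      (by omega : 0 < n + 2), addr_inj (lt x') (lt y') (by omega : 0 < n + 2) (lt x) (lt y) l1,
      pushStk, h.count k' x' y', Fin.val_inj]
    by_cases hc : k' = k ∧ x' = x ∧ y' = y
    · obtain ⟨rfl, rfl, rfl⟩ := hc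
      simp
    · rw [if_neg (by omega), if_neg (by omega), if_neg hc]
  · intro k' x' y' i hi
    have hi' : i < n + 2 := by
      unfold pushStk at hi
      split_ifs at hi
      · simp at hi; omega
      · exact hi.trans (h.len _ _ _)
    simp only [Function.update_apply, addr_inj (lt x') (lt y') hi' (lt x) (lt y)
      (by omega : 0 < n + 2), addr_inj (lt x') (lt y') hi' (lt x) (lt y) l1, Fin.val_inj]
    rw [if_neg (by omega)]
    by_cases hc : k' = k ∧ x' = x ∧ y' = y
    · obtain ⟨rfl, rfl, rfl⟩ := hc
      simp only [pushStk, and_self, if_true, true_and] at hi ⊢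
      by_cases hil : i = (stk k' x' y').length
      · subst hil
        simp
      · rw [if_neg hil]
        rw [List.length_append, List.length_singleton] at hi
        rw [h.entry _ _ _ i (by omega), List.getElem_append_left]
    · simp only [pushStk, hc, if_false] at hi ⊢
      rw [if_neg (by omega)]
      exact h.entry _ _ _ i hi
  · intro k' x' y'
    unfold pushStk
    split_ifs
    · simp; omega
    · exact h.len _ _ _

/-- Push the content of register `v` on the stack `k` with the indices in registers `x, y`. -/
def push (k x y v : ℕ) : Prog :=
  .seq (fetch 10 (2 * k + 1) x y 17) <| .seq (put (2 * k + 2) x y 10 v) <|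
  .seq (.add 10 10 15) <| put (2 * k + 1) x y 17 10

theorem wp_push {w n : ℕ} {Q : State → ℕ → Prop} {s : State} {inp : List ℕ}
    {stk : ℕ → Fin n → Fin n → List (Fin n)} {k x y v : ℕ} {X Y V : Fin n}
    (hW : 5 * (n + 2) ^ 3 ≤ 2 ^ w) (hk : k ≤ 1) (hB : s.reg 0 = n + 2)
    (h15 : s.reg 15 = 1) (h17 : s.reg 17 = 0)
    (hx : s.reg x = X) (hy : s.reg y = Y) (hv : s.reg v = V)
    (hx' : x ≠ 14 ∧ x ≠ 10) (hy' : y ≠ 14 ∧ y ≠ 10) (hv' : v ≠ 14 ∧ v ≠ 10)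
    (hS : Stacks n inp s.mem stk) (hlen : (stk k X Y).length ≤ n)
    (h : ∀ s', Stacks n inp s'.mem (pushStk stk k X Y V) → s'.out = s.out →
      (∀ r, r ∉ [10, 14] → s'.reg r = s.reg r) → Q s' 25) : wp w (push k x y v) Q s := by
  have hX := X.isLt
  have hY := Y.isLt
  have hc : n + 2 < 2 ^ w := by nlinarith [Nat.zero_le (n ^ 3), Nat.zero_le (n ^ 2)]
  refine wp_seq (wp_fetch hW (by omega) hB hx hy h17 hx'.1 hy'.1 (by norm_num) (by omega) (by omega)
    (by omega) (hS.count k X Y) (by omega) ?_)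
  refine wp_seq (wp_put hW (by omega) (X := X) (Y := Y) (Z := (stk k X Y).length) (V := V)
    (by simpa using hB) (by simpa [hx'] using hx) (by simpa [hy'] using hy)
    (by simp) hx'.1 hy'.1 (by norm_num) (by omega) (by omega) (by omega)
    (by simpa [hv'] using hv) hv'.1 ?_)
  refine wp_seq (wp_add (a := (stk k X Y).length) (b := 1) (by simp) (by simpa using h15)
    (by omega) ?_)
  refine wp_put hW (by omega) (X := X) (Y := Y) (Z := 0) (V := (stk k X Y).length + 1)
    (by simpa using hB) (by simpa [hx'] using hx) (by simpa [hy'] using hy)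
    (by simpa using h17) hx'.1 hy'.1 (by norm_num) (by omega) (by omega) (by omega)
    (by simp) (by norm_num) ?_
  refine h _ ?_ (by simp) ?_
  · simpa using hS.push V hlen
  · intro r hr
    simp only [List.mem_cons, List.not_mem_nil, or_false, not_or] at hr
    simp [hr]

end WordRAM

/-! ### The program and its data. -/

namespace FourCycle

open WordRAM

/-- The words printed for a list of quadruples. -/
def flat {n : ℕ} (L : List (Fin n × Fin n × Fin n × Fin n)) : List ℕ :=
  L.flatMap fun q => [(q.1 : ℕ), (q.2.1 : ℕ), (q.2.2.1 : ℕ), (q.2.2.2 : ℕ)]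

/-- The order of the nodes by degree, with ties broken by number. -/
def degKey {n : ℕ} (E : List (Fin n × Fin n)) (x : Fin n) : ℕ := (nbrs E x).length * (n + 2) + x

theorem degKey_injective {n : ℕ} (E : List (Fin n × Fin n)) : Function.Injective (degKey E) := by
  intro x y h
  exact Fin.ext ((digit_inj (by omega) (by omega)).1 h).2

/-- The stacks of the program: stack `0, v, v` holds the neighbours of `v`, stack `1, v, w` the
middle nodes of the recorded paths from `v` to `w`. -/
def tables {n : ℕ} (E : List (Fin n × Fin n)) (P : List (Fin n × Fin n × Fin n)) (k : ℕ)
    (x y : Fin n) : List (Fin n) :=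
  if k = 0 then if x = y then nbrs E x else [] else if k = 1 then mids P x y else []

theorem pushStk_tables_one {n : ℕ} (E : List (Fin n × Fin n)) (P : List (Fin n × Fin n × Fin n))
    (v u x : Fin n) : pushStk (tables E P) 1 v x u = tables E ((v, u, x) :: P) := by
  funext k a b
  by_cases h0 : k = 0
  · simp [pushStk, tables, h0]
  by_cases h1 : k = 1
  · subst h1
    simp only [pushStk, tables, mids, true_and, one_ne_zero, if_false, if_true]
    by_cases h : a = v ∧ b = x
    · rw [if_pos h, if_pos ⟨h.1.symm, h.2.symm⟩, h.1, h.2]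
    · rw [if_neg h, if_neg fun h' => h ⟨h'.1.symm, h'.2.symm⟩]
  · simp [pushStk, tables, h0, h1]

theorem nbrs_append {n : ℕ} (E : List (Fin n × Fin n)) (e : Fin n × Fin n) (v : Fin n) :
    nbrs (E ++ [e]) v =
      nbrs E v ++ ((if e.1 = v then [e.2] else []) ++ if e.2 = v then [e.1] else []) := by
  simp [nbrs]

/-- Since the edge is not a loop, the two pushes go to different stacks. -/
theorem pushStk_tables_zero {n : ℕ} (E : List (Fin n × Fin n)) (e : Fin n × Fin n)
    (h : e.1 ≠ e.2) :
    pushStk (pushStk (tables E []) 0 e.1 e.1 e.2) 0 e.2 e.2 e.1 = tables (E ++ [e]) [] := by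
  funext k a b
  by_cases h0 : k = 0
  · subst h0
    simp only [pushStk, tables, nbrs_append, true_and, if_true]
    by_cases hab : a = b
    · subst hab
      by_cases h1 : a = e.1
      · subst h1
        simp [h, h.symm]
      · by_cases h2 : a = e.2
        · subst h2
          simp [h, h.symm]
        · simp [h1, h2, Ne.symm h1, Ne.symm h2]
    · rw [if_neg, if_neg, if_neg hab, if_neg hab]
      · rintro ⟨rfl, rfl⟩; exact hab rfl
      · rintro ⟨rfl, rfl⟩; exact hab rfl
  · simp [pushStk, tables, h0]

theorem extend_append {n : ℕ} (key : Fin n → ℕ) (v u : Fin n) (l₁ l₂ : List (Fin n)) :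
    extend key v u (l₁ ++ l₂) = extend key v u l₁ ++ extend key v u l₂ := by
  simp [extend]

theorem length_le_of_nodup {n : ℕ} {l : List (Fin n)} (h : l.Nodup) : l.length ≤ n := by
  simpa using h.length_le_card

/-- Register `d` gets the key of the node in register `x`. -/
def setKey (d x : ℕ) : Prog := .seq (fetch d 1 x x 17) <| .seq (.mul d d 0) <| .add d d x

/-- Registers `4` and `5` get the endpoints of the next edge of the input. -/
def readEdge : Prog :=
  .seq (.load 4 2) <| .seq (.add 2 2 15) <| .seq (.load 5 2) <| .add 2 2 15

/-- Make the adjacency lists. -/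
def buildLists : Prog :=
  .loop (.lt 2 3) <| .seq readEdge <| .seq (push 0 4 4 5) <| push 0 5 5 4

/-- Print the 4-cycles of the path in registers `4, 5, 8` with the recorded paths. -/
def printPairs : Prog :=
  .seq (fetch 10 3 4 8 17) <| .seq (.copy 9 17) <| .loop (.lt 9 10) <|
  .seq (fetch 11 4 4 8 9) <| .seq (.print 4) <| .seq (.print 5) <| .seq (.print 8) <|
  .seq (.print 11) <| .add 9 9 15

/-- Handle the path that goes from registers `4, 5` to neighbour number `6`. -/
def visit : Prog :=
  .seq (fetch 8 2 5 5 6) <| .seq (setKey 13 8) <|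
  .seq (.ite (.lt 13 12) (.seq printPairs (push 1 4 8 5)) .skip) <| .add 6 6 15

/-- Handle all paths that start with the directed edge in registers `4, 5`. -/
def scan : Prog := .seq (fetch 7 1 5 5 17) <| .seq (.copy 6 17) <| .loop (.lt 6 7) visit

/-- Direct the edge in registers `4, 5` from its larger endpoint, whose key goes to `12`. -/
def orientEdge : Prog :=
  .seq (setKey 12 4) <| .seq (setKey 13 5) <|
  .ite (.lt 12 13) (.seq (.copy 8 4) <| .seq (.copy 4 5) <| .seq (.copy 5 8) <| .copy 12 13) .skip

/-- Handle all edges. -/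
def search : Prog := .loop (.lt 2 3) <| .seq readEdge <| .seq orientEdge scan

/-- Read the sizes and set the constants. -/
def setup : Prog :=
  .seq (.const 15 1) <| .seq (.load 0 17) <| .seq (.load 1 15) <| .seq (.const 16 2) <|
  .seq (.add 0 0 16) <| .seq (.add 3 1 1) <| .seq (.add 3 3 16) <| .copy 2 16

/-- The program that lists all 4-cycles. -/
def program : Prog := .seq setup <| .seq buildLists <| .seq (.copy 2 16) search

/-- The registers that are constant after the setup. -/
structure Ready (n m : ℕ) (s : State) : Prop where
  r0 : s.reg 0 = n + 2
  r3 : s.reg 3 = 2 * m + 2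
  r15 : s.reg 15 = 1
  r16 : s.reg 16 = 2
  r17 : s.reg 17 = 0

theorem Ready.of_eq {n m : ℕ} {s s' : State} (h : Ready n m s)
    (hr : ∀ r ∈ [0, 3, 15, 16, 17], s'.reg r = s.reg r) : Ready n m s' :=
  ⟨(hr 0 (by simp)).trans h.r0, (hr 3 (by simp)).trans h.r3, (hr 15 (by simp)).trans h.r15,
    (hr 16 (by simp)).trans h.r16, (hr 17 (by simp)).trans h.r17⟩

/-! ### Correctness and cost of each piece of the program. -/

section Specs

variable {w n m : ℕ} {Q : State → ℕ → Prop} {s : State} {inp : List ℕ}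
  {E : List (Fin n × Fin n)} {P : List (Fin n × Fin n × Fin n)}

theorem wp_setKey {d x : ℕ} {X : Fin n} (hW : 5 * (n + 2) ^ 3 ≤ 2 ^ w) (hR : Ready n m s)
    (hS : Stacks n inp s.mem (tables E P)) (hx : s.reg x = X) (hx' : x ≠ 14)
    (hd : d ≠ 0 ∧ d ≠ x)
    (h : Q ((s.upd 14 (addr (n + 2) 1 X X 0)).upd d (degKey E X)) 10) :
    wp w (setKey d x) Q s := by
  have hX := X.isLt
  have hc := hS.count 0 X X
  have hl := hS.len 0 X X
  simp only [tables, if_true, mul_zero, zero_add] at hc hl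
  have b1 : (nbrs E X).length * (n + 2) ≤ (n + 1) * (n + 2) := Nat.mul_le_mul_right _ (by omega)
  have b2 : (n + 1) * (n + 2) + n < 5 * (n + 2) ^ 3 := by
    nlinarith [Nat.zero_le (n ^ 3), Nat.zero_le (n ^ 2)]
  have b3 : (nbrs E X).length ≤ (nbrs E X).length * (n + 2) :=
    Nat.le_mul_of_pos_right _ (by omega)
  refine wp_seq (wp_fetch hW (by norm_num) hR.r0 hx hx hR.r17 hx' hx' (by norm_num) (by omega)
    (by omega) (by omega) hc (by omega) ?_)
  refine wp_seq (wp_mul (a := (nbrs E X).length) (b := n + 2) (by simp)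
    (by simpa [hd.1.symm] using hR.r0) (by omega) ?_)
  refine wp_add (a := (nbrs E X).length * (n + 2)) (b := X) (by simp)
    (by simpa [hd.2.symm, hx'] using hx) (by omega) ?_
  simpa [degKey] using h

/-- One round costs a fetch of 8, four prints, an increment and a test, 14 in all. -/
theorem wp_printPairs {V U X : Fin n} (hW : 5 * (n + 2) ^ 3 ≤ 2 ^ w) (hR : Ready n m s)
    (hS : Stacks n inp s.mem (tables E P)) (h4 : s.reg 4 = V) (h5 : s.reg 5 = U)
    (h8 : s.reg 8 = X)
    (h : ∀ s', s'.mem = s.mem →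
      s'.out = s.out ++ flat ((mids P V X).map fun x => (V, U, X, x)) →
      (∀ r, r ∉ [9, 10, 11, 14] → s'.reg r = s.reg r) →
      Q s' (14 * (mids P V X).length + 10)) : wp w printPairs Q s := by
  have hV := V.isLt
  have hX := X.isLt
  have hc := hS.count 1 V X
  have hl := hS.len 1 V X
  simp only [tables, one_ne_zero, if_true, if_false] at hc hl
  have b1 : n + 2 < 2 ^ w := by nlinarith [Nat.zero_le (n ^ 3), Nat.zero_le (n ^ 2)]
  refine wp_seq (wp_fetch hW (by norm_num) hR.r0 h4 h8 hR.r17 (by norm_num) (by norm_num)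
    (by norm_num) (by omega) (by omega) (by omega) hc (by omega) ?_)
  refine wp_seq (wp_copy (v := 0) (by simpa using hR.r17) (by omega) ?_)
  refine wp_for (mids P V X) (fun l₁ s' τ => s'.mem = s.mem ∧
    s'.out = s.out ++ flat (l₁.map fun x => (V, U, X, x)) ∧ s'.reg 9 = l₁.length ∧
    s'.reg 10 = (mids P V X).length ∧
    (∀ r, r ∉ [9, 10, 11, 14] → s'.reg r = s.reg r) ∧ τ = 14 * l₁.length) ?_ ?_ ?_ ?_ ?_
  · refine ⟨by simp, by simp [flat], by simp, by simp, ?_, rfl⟩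
    intro r hr
    simp only [List.mem_cons, List.not_mem_nil, or_false, not_or] at hr
    simp [hr]
  · rintro l₁ x l₂ s' τ hl ⟨-, -, h9, h10, -⟩
    simp [Test.holds, h9, h10, hl]
  · rintro s' τ ⟨-, -, h9, h10, -⟩
    simp [Test.holds, h9, h10]
  · rintro l₁ x l₂ s' τ hsplit ⟨hm, ho, h9, h10, hf, rfl⟩
    have hlen : l₁.length < (mids P V X).length := by rw [hsplit]; simp
    have hx := x.isLt
    have he : s'.mem (addr (n + 2) 4 V X l₁.length) = x := by
      have := hS.entry 1 V X l₁.length (by simpa [tables] using hlen)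
      rw [hm, this]
      simp [tables, hsplit]
    refine wp_seq (wp_fetch hW (by norm_num) ((hf 0 (by simp)).trans hR.r0)
      ((hf 4 (by simp)).trans h4) ((hf 8 (by simp)).trans h8) h9 (by norm_num) (by norm_num)
      (by norm_num) (by omega) (by omega) (by omega) he (by omega) ?_)
    refine wp_seq (wp_print (v := V) (by simpa [hf 4] using h4) ?_)
    refine wp_seq (wp_print (v := U) (by simpa [hf 5] using h5) ?_)
    refine wp_seq (wp_print (v := X) (by simpa [hf 8] using h8) ?_)
    refine wp_seq (wp_print (v := x) (by simp) ?_)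
    refine wp_add (a := l₁.length) (b := 1) (by simpa using h9)
      (by simpa [hf 15] using hR.r15) (by omega) ?_
    refine ⟨by simpa using hm, by simp [ho, flat], by simp, by simpa using h10, ?_, ?_⟩
    · intro r hr
      have := hf r hr
      simp only [List.mem_cons, List.not_mem_nil, or_false, not_or] at hr
      simp [hr, this]
    · simp only [List.length_append, List.length_singleton]
      omega
  · rintro s' τ ⟨hm, ho, -, -, hf, rfl⟩
    convert h s' hm ho hf using 1
    omega

/-- The time is amortised: 14 steps are charged to each newly printed cycle and at most 60 to the
visit itself. Adding the old output length on the left avoids truncated subtraction. -/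
theorem wp_visit {V U x : Fin n} {l₁ l₂ : List (Fin n)} (hW : 5 * (n + 2) ^ 3 ≤ 2 ^ w)
    (hR : Ready n m s) (hS : Stacks n inp s.mem (tables E P)) (hsplit : nbrs E U = l₁ ++ x :: l₂)
    (h4 : s.reg 4 = V) (h5 : s.reg 5 = U) (h6 : s.reg 6 = l₁.length)
    (h12 : s.reg 12 = degKey E V) (hP : P.Nodup) (ho : s.out = flat (pairUp P))
    (h : ∀ s' T, Stacks n inp s'.mem (tables E ((extend (degKey E) V U [x]).reverse ++ P)) →
      s'.out = flat (pairUp ((extend (degKey E) V U [x]).reverse ++ P)) →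
      s'.reg 6 = l₁.length + 1 → (∀ r, r ∉ [6, 8, 9, 10, 11, 13, 14] → s'.reg r = s.reg r) →
      T + 14 * (pairUp P).length ≤
        60 + 14 * (pairUp ((extend (degKey E) V U [x]).reverse ++ P)).length → Q s' T) :
    wp w visit Q s := by
  have hV := V.isLt
  have hU := U.isLt
  have hx := x.isLt
  have b1 : n + 2 < 2 ^ w := by nlinarith [Nat.zero_le (n ^ 3), Nat.zero_le (n ^ 2)]
  have hl : l₁.length < n + 2 := by
    have := hS.len 0 U U
    simp only [tables, if_true, hsplit, List.length_append] at this
    omega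
  have he : s.mem (addr (n + 2) 2 U U l₁.length) = x := by
    have := hS.entry 0 U U l₁.length (by simp [tables, hsplit])
    rw [this]
    simp [tables, hsplit]
  refine wp_seq (wp_fetch hW (by norm_num) hR.r0 h5 h5 h6 (by norm_num) (by norm_num)
    (by norm_num) (by omega) (by omega) (by omega) he (by omega) ?_)
  set s₁ := (s.upd 14 (addr (n + 2) 2 U U l₁.length)).upd 8 x with hs₁
  have hR₁ : Ready n m s₁ := hR.of_eq (by simp [hs₁])
  refine wp_seq (wp_setKey hW hR₁ (by simpa [hs₁] using hS) (X := x) (by simp [hs₁])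
    (by norm_num) (by norm_num) ?_)
  set s₂ := (s₁.upd 14 (addr (n + 2) 1 x x 0)).upd 13 (degKey E x) with hs₂
  have hR₂ : Ready n m s₂ := hR₁.of_eq (by simp [hs₂])
  have hS₂ : Stacks n inp s₂.mem (tables E P) := by simpa [hs₂, hs₁] using hS
  have hf₂ : ∀ r, r ∉ [8, 13, 14] → s₂.reg r = s.reg r := by
    intro r hr
    simp only [List.mem_cons, List.not_mem_nil, or_false, not_or] at hr
    simp [hs₂, hs₁, hr]
  have ho₂ : s₂.out = s.out := by simp [hs₂, hs₁]
  have h8 : s₂.reg 8 = x := by simp [hs₂, hs₁]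
  have h13 : s₂.reg 13 = degKey E x := by simp [hs₂]
  have h12' : s₂.reg 12 = degKey E V := (hf₂ 12 (by simp)).trans h12
  by_cases hlt : degKey E x < degKey E V
  · have hext : (extend (degKey E) V U [x]).reverse ++ P = (V, U, x) :: P := by
      simp [extend, hlt]
    rw [hext] at h
    refine wp_seq (wp_ite_pos (by simpa [Test.holds, h13, h12'] using hlt) ?_)
    refine wp_seq (wp_printPairs hW hR₂ hS₂ ((hf₂ 4 (by simp)).trans h4)
      ((hf₂ 5 (by simp)).trans h5) h8 ?_)
    intro s₃ hm₃ ho₃ hf₃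
    have hR₃ : Ready n m s₃ := hR₂.of_eq (by simp [hf₃])
    refine wp_push (X := V) (Y := x) (V := U) hW (by norm_num) hR₃.r0 hR₃.r15 hR₃.r17
      (by rw [hf₃ 4 (by simp), hf₂ 4 (by simp), h4]) (by rw [hf₃ 8 (by simp), h8])
      (by rw [hf₃ 5 (by simp), hf₂ 5 (by simp), h5]) (by norm_num) (by norm_num) (by norm_num)
      (by rw [hm₃]; exact hS₂) (by simpa [tables] using length_le_of_nodup (nodup_mids hP V x)) ?_
    intro s₄ hS₄ ho₄ hf₄
    rw [pushStk_tables_one] at hS₄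
    have h6' : s₄.reg 6 = l₁.length := by
      rw [hf₄ 6 (by simp), hf₃ 6 (by simp), hf₂ 6 (by simp), h6]
    have h15 : s₄.reg 15 = 1 := by rw [hf₄ 15 (by simp), hR₃.r15]
    refine wp_add h6' h15 (by omega) ?_
    refine h _ _ hS₄ ?_ (by simp) ?_ ?_
    · simp [ho₄, ho₃, ho₂, ho, pairUp, flat]
    · intro r hr
      simp only [List.mem_cons, List.not_mem_nil, or_false, not_or] at hr
      simp [hr, hf₄, hf₃, hf₂]
    · simp only [pairUp, List.length_append, List.length_map]
      omega
  · have hext : (extend (degKey E) V U [x]).reverse ++ P = P := by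
      simp [extend, hlt]
    rw [hext] at h
    refine wp_seq (wp_ite_neg (by simpa [Test.holds, h13, h12'] using hlt) (wp_skip ?_))
    refine wp_add (a := l₁.length) (b := 1) (by rw [hf₂ 6 (by simp), h6]) hR₂.r15 (by omega) ?_
    refine h _ _ hS₂ (by simp [ho₂, ho]) (by simp) ?_ (by omega)
    intro r hr
    simp only [List.mem_cons, List.not_mem_nil, or_false, not_or] at hr
    simp [hr, hf₂]

theorem wp_scan {V U : Fin n} (hW : 5 * (n + 2) ^ 3 ≤ 2 ^ w)
    (hR : Ready n m s) (hS : Stacks n inp s.mem (tables E P))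
    (h4 : s.reg 4 = V) (h5 : s.reg 5 = U) (h12 : s.reg 12 = degKey E V)
    (hP : ((extend (degKey E) V U (nbrs E U)).reverse ++ P).Nodup)
    (ho : s.out = flat (pairUp P))
    (h : ∀ s' T, Stacks n inp s'.mem
        (tables E ((extend (degKey E) V U (nbrs E U)).reverse ++ P)) →
      s'.out = flat (pairUp ((extend (degKey E) V U (nbrs E U)).reverse ++ P)) →
      (∀ r, r ∉ [6, 7, 8, 9, 10, 11, 13, 14] → s'.reg r = s.reg r) →
      T + 14 * (pairUp P).length ≤ 10 + 61 * (nbrs E U).length +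
        14 * (pairUp ((extend (degKey E) V U (nbrs E U)).reverse ++ P)).length → Q s' T) :
    wp w scan Q s := by
  have hU := U.isLt
  have hc := hS.count 0 U U
  have hl := hS.len 0 U U
  simp only [tables, if_true, mul_zero, zero_add] at hc hl
  have b1 : n + 2 < 2 ^ w := by nlinarith [Nat.zero_le (n ^ 3), Nat.zero_le (n ^ 2)]
  refine wp_seq (wp_fetch hW (by norm_num) hR.r0 h5 h5 hR.r17 (by norm_num) (by norm_num)
    (by norm_num) (by omega) (by omega) (by omega) hc (by omega) ?_)
  refine wp_seq (wp_copy (v := 0) (by simpa using hR.r17) (by omega) ?_)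
  refine wp_for (nbrs E U) (fun l₁ s' τ =>
    Stacks n inp s'.mem (tables E ((extend (degKey E) V U l₁).reverse ++ P)) ∧
    s'.out = flat (pairUp ((extend (degKey E) V U l₁).reverse ++ P)) ∧
    s'.reg 6 = l₁.length ∧ s'.reg 7 = (nbrs E U).length ∧
    (∀ r, r ∉ [6, 7, 8, 9, 10, 11, 13, 14] → s'.reg r = s.reg r) ∧
    τ + 14 * (pairUp P).length ≤ 61 * l₁.length +
      14 * (pairUp ((extend (degKey E) V U l₁).reverse ++ P)).length) ?_ ?_ ?_ ?_ ?_
  · refine ⟨by simpa [extend] using hS, by simpa [extend] using ho, by simp, by simp, ?_,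
      by simp [extend]⟩
    intro r hr
    simp only [List.mem_cons, List.not_mem_nil, or_false, not_or] at hr
    simp [hr]
  · rintro l₁ x l₂ s' τ hl ⟨-, -, h6, h7, -⟩
    simp [Test.holds, h6, h7, hl]
  · rintro s' τ ⟨-, -, h6, h7, -⟩
    simp [Test.holds, h6, h7]
  · rintro l₁ x l₂ s' τ hsplit ⟨hS', ho', h6, h7, hf, hτ⟩
    -- Distinct recorded paths keep every stack of middle nodes duplicate-free, so it has room for
    -- the next push.
    have hnd : ((extend (degKey E) V U l₁).reverse ++ P).Nodup := by
      rw [hsplit, extend_append, List.reverse_append, List.append_assoc] at hP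
      exact (List.nodup_append.1 hP).2.1
    refine wp_visit hW (hR.of_eq (by simp [hf])) hS' hsplit ((hf 4 (by simp)).trans h4)
      ((hf 5 (by simp)).trans h5) h6 ((hf 12 (by simp)).trans h12) hnd ho' ?_
    intro s'' T hS'' ho'' h6'' hf'' hT
    have hext : (extend (degKey E) V U (l₁ ++ [x])).reverse ++ P =
        (extend (degKey E) V U [x]).reverse ++ ((extend (degKey E) V U l₁).reverse ++ P) := by
      rw [extend_append, List.reverse_append, List.append_assoc]
    rw [hext]
    refine ⟨hS'', ho'', by simpa using h6'', (hf'' 7 (by simp)).trans h7, ?_, ?_⟩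
    · intro r hr
      rw [← hf r hr]
      apply hf''
      simp only [List.mem_cons, List.not_mem_nil, or_false, not_or] at hr ⊢
      tauto
    · simp only [List.length_append (as := l₁), List.length_singleton]
      omega
  · rintro s' τ ⟨hS', ho', -, -, hf, hτ⟩
    exact h s' _ hS' ho' hf (by omega)

theorem wp_orientEdge {e : Fin n × Fin n} (hW : 5 * (n + 2) ^ 3 ≤ 2 ^ w)
    (hR : Ready n m s) (hS : Stacks n inp s.mem (tables E P))
    (h4 : s.reg 4 = e.1) (h5 : s.reg 5 = e.2)
    (h : ∀ s' T, s'.mem = s.mem → s'.out = s.out → s'.reg 4 = ((orient (degKey E) e).1 : ℕ) →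
      s'.reg 5 = ((orient (degKey E) e).2 : ℕ) → s'.reg 12 = degKey E (orient (degKey E) e).1 →
      (∀ r, r ∉ [4, 5, 8, 12, 13, 14] → s'.reg r = s.reg r) → T ≤ 25 → Q s' T) :
    wp w orientEdge Q s := by
  have h1 := e.1.isLt
  have h2 := e.2.isLt
  have b1 : n + 2 < 2 ^ w := by nlinarith [Nat.zero_le (n ^ 3), Nat.zero_le (n ^ 2)]
  have b2 : degKey E e.2 < 2 ^ w := by
    have hl := hS.len 0 e.2 e.2
    simp only [tables, if_true] at hl
    have b1 : (nbrs E e.2).length * (n + 2) ≤ (n + 1) * (n + 2) :=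
      Nat.mul_le_mul_right _ (by omega)
    have b2 : (n + 1) * (n + 2) + n < 5 * (n + 2) ^ 3 := by
      nlinarith [Nat.zero_le (n ^ 3), Nat.zero_le (n ^ 2)]
    unfold degKey
    omega
  refine wp_seq (wp_setKey hW hR hS h4 (by norm_num) (by norm_num) ?_)
  refine wp_seq (wp_setKey (X := e.2) hW (hR.of_eq (by simp)) (by simpa using hS)
    (by simpa using h5) (by norm_num) (by norm_num) ?_)
  by_cases hlt : degKey E e.1 < degKey E e.2
  · have ho : orient (degKey E) e = (e.2, e.1) := if_pos hlt
    rw [ho] at h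
    refine wp_ite_pos (by simpa [Test.holds] using hlt) ?_
    refine wp_seq (wp_copy (v := e.1) (by simpa using h4) (by omega) ?_)
    refine wp_seq (wp_copy (v := e.2) (by simpa using h5) (by omega) ?_)
    refine wp_seq (wp_copy (v := e.1) (by simp) (by omega) ?_)
    refine wp_copy (v := degKey E e.2) (by simp) b2 ?_
    refine h _ _ (by simp) (by simp) (by simp) (by simp) (by simp) ?_ (by norm_num)
    intro r hr
    simp only [List.mem_cons, List.not_mem_nil, or_false, not_or] at hr
    simp [hr]
  · have ho : orient (degKey E) e = e := if_neg hlt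
    rw [ho] at h
    refine wp_ite_neg (by simpa [Test.holds] using hlt) (wp_skip ?_)
    refine h _ _ (by simp) (by simp) (by simpa using h4) (by simpa using h5) (by simp) ?_
      (by norm_num)
    intro r hr
    simp only [List.mem_cons, List.not_mem_nil, or_false, not_or] at hr
    simp [hr]

theorem length_encodeInput (E : List (Fin n × Fin n)) :
    (encodeInput E).length = 2 * E.length + 2 := by
  simp [encodeInput, List.length_flatMap, mul_comm]

theorem getD_encodeInput {l₁ l₂ : List (Fin n × Fin n)} {e : Fin n × Fin n} :
    (encodeInput (l₁ ++ e :: l₂)).getD (2 + 2 * l₁.length) 0 = e.1 ∧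
      (encodeInput (l₁ ++ e :: l₂)).getD (2 + 2 * l₁.length + 1) 0 = e.2 := by
  have hsplit : encodeInput (l₁ ++ e :: l₂) =
      (n :: (l₁ ++ e :: l₂).length :: l₁.flatMap fun e => [(e.1 : ℕ), (e.2 : ℕ)]) ++
        ((e.1 : ℕ) :: (e.2 : ℕ) :: l₂.flatMap fun e => [(e.1 : ℕ), (e.2 : ℕ)]) := by
    simp [encodeInput]
  have hlen : (n :: (l₁ ++ e :: l₂).length ::
      l₁.flatMap fun e => [(e.1 : ℕ), (e.2 : ℕ)]).length = 2 + 2 * l₁.length := by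
    simp [List.length_flatMap]
    omega
  rw [hsplit]
  constructor
  · rw [List.getD_append_right _ _ _ _ (by omega), hlen]
    simp
  · rw [List.getD_append_right _ _ _ _ (by omega), hlen]
    simp

theorem wp_readEdge {l₁ l₂ : List (Fin n × Fin n)} {e : Fin n × Fin n}
    {stk : ℕ → Fin n → Fin n → List (Fin n)} (hW : 5 * (n + 2) ^ 3 ≤ 2 ^ w)
    (hm : 2 * (l₁ ++ e :: l₂).length + 2 ≤ (n + 2) ^ 3) (hR : Ready n m s)
    (hS : Stacks n (encodeInput (l₁ ++ e :: l₂)) s.mem stk) (h2 : s.reg 2 = 2 + 2 * l₁.length)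
    (h : ∀ s', s'.mem = s.mem → s'.out = s.out → s'.reg 4 = (e.1 : ℕ) → s'.reg 5 = (e.2 : ℕ) →
      s'.reg 2 = 2 + 2 * (l₁ ++ [e]).length → (∀ r, r ∉ [2, 4, 5] → s'.reg r = s.reg r) → Q s' 4) :
    wp w readEdge Q s := by
  have h1' := e.1.isLt
  have h2' := e.2.isLt
  have b1 : n + 2 < 2 ^ w := by nlinarith [Nat.zero_le (n ^ 3), Nat.zero_le (n ^ 2)]
  simp only [List.length_append, List.length_cons] at hm
  have g1 := hS.input (2 + 2 * l₁.length) (by omega)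
  have g2 := hS.input (2 + 2 * l₁.length + 1) (by omega)
  rw [getD_encodeInput.1] at g1
  rw [getD_encodeInput.2] at g2
  refine wp_seq (wp_load h2 g1 (by omega) ?_)
  refine wp_seq (wp_add (a := 2 + 2 * l₁.length) (b := 1) (by simpa using h2)
    (by simpa using hR.r15) (by omega) ?_)
  refine wp_seq (wp_load (A := 2 + 2 * l₁.length + 1) (v := e.2) (by simp) (by simpa using g2)
    (by omega) ?_)
  refine wp_add (a := 2 + 2 * l₁.length + 1) (b := 1) (by simp) (by simpa using hR.r15)
    (by omega) ?_
  refine h _ (by simp) (by simp) (by simp) (by simp) ?_ ?_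
  · simp
    omega
  · intro r hr
    simp only [List.mem_cons, List.not_mem_nil, or_false, not_or] at hr
    simp [hr]

variable {G : SimpleGraph (Fin n)}

theorem wp_buildLists (hE : IsEdgeList G E) (hW : 5 * (n + 2) ^ 3 ≤ 2 ^ w)
    (hm : 2 * E.length + 2 ≤ (n + 2) ^ 3) (hR : Ready n E.length s)
    (hS : Stacks n (encodeInput E) s.mem (tables [] [])) (h2 : s.reg 2 = 2)
    (h : ∀ s', Stacks n (encodeInput E) s'.mem (tables E []) → s'.out = s.out →
      Ready n E.length s' → Q s' (55 * E.length + 1)) :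
    wp w buildLists Q s := by
  refine wp_for E (fun l₁ s' τ => Stacks n (encodeInput E) s'.mem (tables l₁ []) ∧
    s'.out = s.out ∧ Ready n E.length s' ∧ s'.reg 2 = 2 + 2 * l₁.length ∧ τ = 55 * l₁.length)
    ⟨hS, rfl, hR, by simpa using h2, rfl⟩ ?_ ?_ ?_ ?_
  · rintro l₁ x l₂ s' τ hl ⟨-, -, hR', h2', -⟩
    simp only [Test.holds, h2', hR'.r3, hl, List.length_append, List.length_cons]
    omega
  · rintro s' τ ⟨-, -, hR', h2', -⟩
    simp only [Test.holds, h2', hR'.r3]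
    omega
  · rintro l₁ e l₂ s₀ τ hsplit ⟨hS₀, ho₀, hR₀, h2₀, rfl⟩
    have hne : e.1 ≠ e.2 := (hE.adj_of_mem (by rw [hsplit]; simp)).ne
    have hlen : ∀ v, (nbrs l₁ v).length ≤ n := fun v =>
      length_le_of_nodup ((hsplit ▸ hE).of_prefix_nodup v)
    refine wp_seq (wp_readEdge hW (hsplit ▸ hm) hR₀ (hsplit ▸ hS₀) h2₀ ?_)
    intro s₁ hm₁ ho₁ h4₁ h5₁ h2₁ hf₁
    have hR₁ : Ready n E.length s₁ := hR₀.of_eq (by simp [hf₁])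
    refine wp_seq (wp_push (X := e.1) (Y := e.1) (V := e.2) hW (by norm_num) hR₁.r0 hR₁.r15
      hR₁.r17 h4₁ h4₁ h5₁ (by norm_num) (by norm_num) (by norm_num) (by rw [hm₁]; exact hS₀)
      (by simpa [tables] using hlen e.1) ?_)
    intro s₂ hS₂ ho₂ hf₂
    have hR₂ : Ready n E.length s₂ := hR₁.of_eq (by simp [hf₂])
    refine wp_push (X := e.2) (Y := e.2) (V := e.1) hW (by norm_num) hR₂.r0 hR₂.r15
      hR₂.r17 (by rw [hf₂ 5 (by simp), h5₁]) (by rw [hf₂ 5 (by simp), h5₁])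
      (by rw [hf₂ 4 (by simp), h4₁]) (by norm_num) (by norm_num) (by norm_num) hS₂
      (by simpa [tables, pushStk, hne.symm] using hlen e.2) ?_
    intro s₃ hS₃ ho₃ hf₃
    rw [pushStk_tables_zero _ _ hne] at hS₃
    refine ⟨hS₃, by rw [ho₃, ho₂, ho₁, ho₀], hR₂.of_eq (by simp [hf₃]),
      by rw [hf₃ 2 (by simp), hf₂ 2 (by simp), h2₁], ?_⟩
    simp only [List.length_append, List.length_singleton]
    omega
  · rintro s' τ ⟨hS', ho', hR', -, rfl⟩
    exact h s' hS' ho' hR'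

/-- The degree is the leading digit of the key, so the lower endpoint never has the larger degree.
-/
theorem length_nbrs_orient_le (e : Fin n × Fin n) :
    (nbrs E (orient (degKey E) e).2).length ≤ min (nbrs E e.1).length (nbrs E e.2).length := by
  have h1 := e.1.isLt
  have h2 := e.2.isLt
  have mono : ∀ x y : Fin n, degKey E x ≤ degKey E y →
      (nbrs E x).length ≤ (nbrs E y).length := by
    intro x y hxy
    by_contra! hlt
    have hx := x.isLt
    have hy := y.isLt
    have : ((nbrs E y).length + 1) * (n + 2) ≤ (nbrs E x).length * (n + 2) :=
      Nat.mul_le_mul_right _ hlt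
    unfold degKey at hxy
    rw [Nat.add_mul] at this
    omega
  unfold orient
  split_ifs with h
  · exact le_min le_rfl (mono _ _ h.le)
  · exact le_min (mono _ _ (not_lt.1 h)) le_rfl

theorem wp_search (hE : IsEdgeList G E) (hW : 5 * (n + 2) ^ 3 ≤ 2 ^ w)
    (hm : 2 * E.length + 2 ≤ (n + 2) ^ 3) (hR : Ready n E.length s)
    (hS : Stacks n (encodeInput E) s.mem (tables E [])) (h2 : s.reg 2 = 2) (ho : s.out = [])
    (h : ∀ s' T, s'.out = flat (pairUp (downPaths (degKey E) (nbrs E) E).reverse) →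
      T ≤ 1 + 40 * E.length +
        61 * (E.map fun e => min (nbrs E e.1).length (nbrs E e.2).length).sum +
        14 * (pairUp (downPaths (degKey E) (nbrs E) E).reverse).length → Q s' T) :
    wp w search Q s := by
  refine wp_for E (fun l₁ s' τ =>
    Stacks n (encodeInput E) s'.mem (tables E (downPaths (degKey E) (nbrs E) l₁).reverse) ∧
    s'.out = flat (pairUp (downPaths (degKey E) (nbrs E) l₁).reverse) ∧
    Ready n E.length s' ∧ s'.reg 2 = 2 + 2 * l₁.length ∧
    τ ≤ 40 * l₁.length +
      61 * (l₁.map fun e => min (nbrs E e.1).length (nbrs E e.2).length).sum +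
      14 * (pairUp (downPaths (degKey E) (nbrs E) l₁).reverse).length)
    ⟨hS, ho, hR, by simpa using h2, by simp⟩ ?_ ?_ ?_ ?_
  · rintro l₁ x l₂ s' τ hl ⟨-, -, hR', h2', -⟩
    simp only [Test.holds, h2', hR'.r3, hl, List.length_append, List.length_cons]
    omega
  · rintro s' τ ⟨-, -, hR', h2', -⟩
    simp only [Test.holds, h2', hR'.r3]
    omega
  · rintro l₁ e l₂ s₀ τ hsplit ⟨hS₀, ho₀, hR₀, h2₀, hτ⟩
    have hsnoc : (downPaths (degKey E) (nbrs E) (l₁ ++ [e])).reverse =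
        (extend (degKey E) (orient (degKey E) e).1 (orient (degKey E) e).2
          (nbrs E (orient (degKey E) e).2)).reverse ++
        (downPaths (degKey E) (nbrs E) l₁).reverse := by
      simp [downPaths]
    have hnd : (downPaths (degKey E) (nbrs E) (l₁ ++ [e])).reverse.Nodup := by
      rw [List.nodup_reverse]
      have hall := hE.nodup_downPaths (key := degKey E)
      have hcat : downPaths (degKey E) (nbrs E) E =
          downPaths (degKey E) (nbrs E) (l₁ ++ [e]) ++ downPaths (degKey E) (nbrs E) l₂ := by
        conv_lhs => rw [downPaths.eq_def, hsplit]
        simp [downPaths, hsplit]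
      rw [hcat] at hall
      exact (List.nodup_append.1 hall).1
    have hin : encodeInput E = encodeInput (l₁ ++ e :: l₂) := by rw [← hsplit]
    refine wp_seq (wp_readEdge hW (hsplit ▸ hm) hR₀ (hin ▸ hS₀) h2₀ ?_)
    intro s₁ hm₁ ho₁ h4₁ h5₁ h2₁ hf₁
    have hR₁ : Ready n E.length s₁ := hR₀.of_eq (by simp [hf₁])
    rw [← hm₁] at hS₀
    refine wp_seq (wp_orientEdge hW hR₁ hS₀ h4₁ h5₁ ?_)
    intro s₂ T₂ hm₂ ho₂ h4₂ h5₂ h12₂ hf₂ hT₂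
    have hR₂ : Ready n E.length s₂ := hR₁.of_eq (by simp [hf₂])
    rw [← hm₂] at hS₀
    rw [hsnoc] at hnd ⊢
    refine wp_scan hW hR₂ hS₀ h4₂ h5₂ h12₂ hnd (by rw [ho₂, ho₁, ho₀]) ?_
    intro s₃ T₃ hS₃ ho₃ hf₃ hT₃
    refine ⟨hS₃, ho₃, hR₂.of_eq (by simp [hf₃]),
      by rw [hf₃ 2 (by simp), hf₂ 2 (by simp), h2₁], ?_⟩
    have := length_nbrs_orient_le (E := E) e
    simp only [List.length_append (as := l₁), List.length_singleton, List.map_append,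
      List.sum_append, List.map_singleton, List.sum_singleton]
    omega
  · rintro s' τ ⟨-, ho', -, -, hτ⟩
    exact h s' _ ho' (by omega)

theorem two_mul_length_le (hE : IsEdgeList G E) : 2 * E.length + 2 ≤ (n + 2) ^ 3 := by
  have hnd : E.Nodup := List.Nodup.of_map _ hE.1
  have := hnd.length_le_card
  simp only [Fintype.card_prod, Fintype.card_fin] at this
  nlinarith [Nat.zero_le (n ^ 3), Nat.zero_le (n ^ 2)]

/-- The input ends below `(n + 2) ^ 3`, so all length cells are zero and every stack is empty
without initialisation. -/
theorem stacks_initState (hE : IsEdgeList G E) :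
    Stacks n (encodeInput E) (initState (encodeInput E)).mem (tables [] []) := by
  have hz : ∀ t x y z, 1 ≤ t → (initState (encodeInput E)).mem (addr (n + 2) t x y z) = 0 := by
    intro t x y z ht
    refine List.getD_eq_default _ _ ?_
    rw [length_encodeInput]
    exact (two_mul_length_le hE).trans (le_addr ht)
  have ht : ∀ k (x y : Fin n), tables [] [] k x y = [] := by
    intro k x y
    simp [tables, nbrs, mids]
  constructor
  · intro i _
    rfl
  · intro k x y
    rw [hz _ _ _ _ (by omega), ht]
    rfl
  · intro k x y i hi
    rw [ht] at hi
    simp at hi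
  · intro k x y
    rw [ht]
    simp

theorem wp_program (hE : IsEdgeList G E) (hW : 5 * (n + 2) ^ 3 ≤ 2 ^ w)
    (h : ∀ s' T, s'.out = flat (pairUp (downPaths (degKey E) (nbrs E) E).reverse) →
      T ≤ 20 + 95 * E.length +
        61 * (E.map fun e => min (nbrs E e.1).length (nbrs E e.2).length).sum +
        14 * (pairUp (downPaths (degKey E) (nbrs E) E).reverse).length → Q s' T) :
    wp w program Q (initState (encodeInput E)) := by
  have hm := two_mul_length_le hE
  have b1 : 2 * (n + 2) < 2 ^ w := by nlinarith [Nat.zero_le (n ^ 3), Nat.zero_le (n ^ 2)]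
  have b2 : 2 * E.length + 2 < 2 ^ w := by
    have : 0 < (n + 2) ^ 3 := by positivity
    omega
  refine wp_seq ?_
  refine wp_seq (wp_const (by omega) ?_)
  refine wp_seq (wp_load (A := 0) (v := n) (by simp [initState]) (by simp [initState, encodeInput])
    (by omega) ?_)
  refine wp_seq (wp_load (A := 1) (v := E.length) (by simp)
    (by simp [initState, encodeInput]) (by omega) ?_)
  refine wp_seq (wp_const (by omega) ?_)
  refine wp_seq (wp_add (a := n) (b := 2) (by simp) (by simp) (by omega) ?_)
  refine wp_seq (wp_add (a := E.length) (b := E.length) (by simp) (by simp) (by omega) ?_)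
  refine wp_seq (wp_add (a := E.length + E.length) (b := 2) (by simp) (by simp) (by omega) ?_)
  refine wp_copy (v := 2) (by simp) (by omega) ?_
  refine wp_seq (wp_buildLists hE hW hm ⟨by simp, by simp; omega, by simp, by simp,
    by simp [initState]⟩ (by simpa using stacks_initState hE) (by simp) ?_)
  intro s₁ hS₁ ho₁ hR₁
  refine wp_seq (wp_copy (v := 2) hR₁.r16 (by omega) ?_)
  refine wp_search hE hW hm (hR₁.of_eq (by simp)) (by simpa using hS₁) (by simp)
    (by simp [ho₁, initState]) ?_
  intro s₂ T₂ ho₂ hT₂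
  exact h s₂ _ ho₂ (by omega)

end Specs


/-! ### From step counts to the stated bound. -/

theorem length_eq_ncard {n : ℕ} {G : SimpleGraph (Fin n)}
    {L : List (Fin n × Fin n × Fin n × Fin n)} (h1 : ∀ q ∈ L, IsFourCycle G q)
    (h2 : (L.map cycleEdges).Nodup) (h3 : ∀ C ∈ fourCycles G, C ∈ L.map cycleEdges) :
    L.length = (fourCycles G).ncard := by
  have : fourCycles G = ↑(L.map cycleEdges).toFinset := by
    ext C
    rw [Finset.mem_coe, List.mem_toFinset]
    refine ⟨h3 C, fun h => ?_⟩
    obtain ⟨q, hq, rfl⟩ := List.mem_map.1 h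
    exact ⟨q, h1 q hq, rfl⟩
  rw [this, Set.ncard_coe_finset, List.toFinset_card_of_nodup h2, List.length_map]

theorem length_le_rpow (m : ℕ) : (m : ℝ) ≤ (m : ℝ) ^ ((4 : ℝ) / 3) := by
  rcases Nat.eq_zero_or_pos m with rfl | hm
  · simp
  · have h1 : (1 : ℝ) ≤ m := by exact_mod_cast hm
    calc (m : ℝ) = (m : ℝ) ^ (1 : ℝ) := (Real.rpow_one _).symm
      _ ≤ _ := Real.rpow_le_rpow_of_exponent_le h1 (by norm_num)

theorem time_bound {n : ℕ} {G : SimpleGraph (Fin n)} {edges : List (Fin n × Fin n)}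
    (hE : IsEdgeList G edges) {T : ℕ}
    (hT : T ≤ 20 + 95 * edges.length +
      61 * (edges.map fun e => min (nbrs edges e.1).length (nbrs edges e.2).length).sum +
      14 * (fourCycles G).ncard) :
    (T : ℝ) ≤ 1000000 * (1 + min
      ((n : ℝ) ^ 2 + ((fourCycles G).ncard : ℝ))
      ((((G.edgeSet.ncard : ℕ) : ℝ) ^ ((4 : ℝ) / 3) +
        ((fourCycles G).ncard : ℝ)) * Real.log n ^ 2)) := by
  set W := (edges.map fun e => min (nbrs edges e.1).length (nbrs edges e.2).length).sum with hW
  have hWle : W ≤ sumMinDeg G := hE.sum_le_sumMinDeg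
  have hlen := hE.length_eq
  have hsq : edges.length ≤ n ^ 2 := by
    have := (List.Nodup.of_map _ hE.1).length_le_card
    simpa [sq] using this
  have hq := card_quads_le G
  have hlog := sumMinDeg_le_log (G := G)
  have hsq2 := sumMinDeg_le_sq (G := G)
  have hWlog : (W : ℝ) ≤ sumMinDeg G := by exact_mod_cast hWle
  have hqR : ((quads G).card : ℝ) ≤ 256 * (fourCycles G).ncard := by exact_mod_cast hq
  have hTR : (T : ℝ) ≤ 20 + 95 * edges.length + 61 * W + 14 * (fourCycles G).ncard := by
    exact_mod_cast hT
  set t : ℝ := ((fourCycles G).ncard : ℝ) with ht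
  have ht0 : 0 ≤ t := Nat.cast_nonneg _
  rw [mul_add, mul_one, mul_min_of_nonneg _ _ (by norm_num), ← min_add_add_left]
  refine le_min ?_ ?_
  · have h1 : (edges.length : ℝ) ≤ (n : ℝ) ^ 2 := by exact_mod_cast hsq
    have h2 : (sumMinDeg G : ℝ) ≤ 4 * (n : ℝ) ^ 2 + (quads G).card := by exact_mod_cast hsq2
    nlinarith [sq_nonneg (n : ℝ)]
  · rw [hlen] at hTR
    set M : ℝ := ((G.edgeSet.ncard : ℕ) : ℝ) ^ ((4 : ℝ) / 3) with hM
    have hmM : ((G.edgeSet.ncard : ℕ) : ℝ) ≤ M := length_le_rpow _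
    have hM0 : 0 ≤ M := by positivity
    -- For `n < 2` the logarithm vanishes and only the summand 1 remains; there are then no edges
    -- and at most 20 steps.
    rcases Nat.lt_or_ge n 2 with hn | hn
    · have hlen0 : edges = [] := by
        rw [List.eq_nil_iff_forall_not_mem]
        intro e he
        have := (hE.adj_of_mem he).ne
        apply this
        ext
        omega
      have ht00 : (fourCycles G).ncard = 0 := by
        rw [Set.ncard_eq_zero]
        rw [Set.eq_empty_iff_forall_notMem]
        rintro C ⟨⟨a, b, c, d⟩, hq', -⟩
        have hab := hq'.1.ne
        apply hab
        ext
        omega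
      have hm0 : G.edgeSet.ncard = 0 := by rw [← hlen, hlen0]; rfl
      have hW0 : W = 0 := by rw [hW, hlen0]; rfl
      rw [hm0, hW0, ht, ht00] at hTR
      have : 0 ≤ (M + t) * Real.log n ^ 2 := by positivity
      norm_num at hTR
      have hT20 : (T : ℝ) ≤ 20 := by exact_mod_cast hTR
      linarith
    · have hl : 0.69 ≤ Real.log n := by
        have h2 : Real.log 2 ≤ Real.log n :=
          Real.log_le_log (by norm_num) (by exact_mod_cast hn)
        linarith [Real.log_two_gt_d9]
      set ℓ := Real.log n with hℓ
      -- From `n ≥ 2`, the logarithm is at least 0.69, so `4 * ℓ ^ 2` dominates both 1 and `1 + ℓ`.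
      have c1 : 1 ≤ 4 * ℓ ^ 2 := by nlinarith
      have c2 : 1 + ℓ ≤ 4 * ℓ ^ 2 := by nlinarith
      have hMt : 0 ≤ M + t := by positivity
      have d1 : M + t ≤ (M + t) * (4 * ℓ ^ 2) := le_mul_of_one_le_right hMt c1
      have d2 : (W : ℝ) ≤ 1536 * ((M + t) * (4 * ℓ ^ 2)) := by
        calc (W : ℝ) ≤ 6 * (M + (quads G).card) * (1 + ℓ) := hWlog.trans hlog
          _ ≤ 6 * (256 * (M + t)) * (4 * ℓ ^ 2) := by
            gcongr
            linarith
          _ = _ := by ring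
      nlinarith

end FourCycle

/-- There is one word-RAM program, correct for every word size `w ≥ c · log₂ (n + 2)`, that lists
all 4-cycles of a graph with `n` nodes, `m` edges and `t` four-cycles, given by its edge list, in
time `O(1 + min (n² + t, (m^(4/3) + t) · log² n))`. -/
theorem theorem1 :
    ∃ (p : WordRAM.Prog) (c : ℕ) (K : ℝ),
      ∀ (n : ℕ) (G : SimpleGraph (Fin n)) (edges : List (Fin n × Fin n)),
        FourCycle.IsEdgeList G edges →
        ∀ w : ℕ, (n + 2) ^ c ≤ 2 ^ w →
          ∃ (s : WordRAM.State) (T : ℕ),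
            WordRAM.Exec w p (WordRAM.initState (FourCycle.encodeInput edges)) s T ∧
            FourCycle.ListsFourCycles G s.out ∧
            (T : ℝ) ≤ K * (1 + min
              ((n : ℝ) ^ 2 + ((FourCycle.fourCycles G).ncard : ℝ))
              ((((G.edgeSet.ncard : ℕ) : ℝ) ^ ((4 : ℝ) / 3) +
                ((FourCycle.fourCycles G).ncard : ℝ)) * Real.log n ^ 2)) := by
  refine ⟨FourCycle.program, 6, 1000000, ?_⟩
  intro n G edges hE w hw
  have hW : 5 * (n + 2) ^ 3 ≤ 2 ^ w := by
    refine le_trans ?_ hw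
    -- Addresses stay below `5 (n + 2)³`, and `(n + 2)³ ≥ 8` absorbs the 5; hence the exponent 6.
    have h8 : 2 ^ 3 ≤ (n + 2) ^ 3 := Nat.pow_le_pow_left (by omega) 3
    calc 5 * (n + 2) ^ 3 ≤ (n + 2) ^ 3 * (n + 2) ^ 3 := Nat.mul_le_mul_right _ (by omega)
      _ = (n + 2) ^ 6 := by ring
  obtain ⟨h1, h2, h3⟩ := hE.listsFourCycles (FourCycle.degKey_injective edges)
    (List.reverse_perm _)
  have hrun := FourCycle.wp_program (Q := fun s T =>
    FourCycle.ListsFourCycles G s.out ∧ (T : ℝ) ≤ 1000000 * (1 + min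
      ((n : ℝ) ^ 2 + ((FourCycle.fourCycles G).ncard : ℝ))
      ((((G.edgeSet.ncard : ℕ) : ℝ) ^ ((4 : ℝ) / 3) +
        ((FourCycle.fourCycles G).ncard : ℝ)) * Real.log n ^ 2))) hE hW ?_
  · exact hrun
  · intro s T ho hT
    rw [FourCycle.length_eq_ncard h1 h2 h3] at hT
    exact ⟨⟨_, ho, h1, h2, h3⟩, FourCycle.time_bound hE hT⟩
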